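/- Let $\mathcal{L}$ be the discrete Fourier transform of length $n_3\ge 1$, $\mathcal{L}(\mathbf a)(k)=\sum_{j=0}^{n_3-1} e^{-2\pi i jk/n_3}\,\mathbf a(j)$, acting on the tubes (the vectors $\mathcal A(i,j,:)$) of third-order tensors. For real tubes put $\mathbf a\bullet\mathbf b=\mathcal{L}^{-1}(\mathcal{L}(\mathbf a)\circ\mathcal{L}(\mathbf b))$ with $\circ$ the entrywise product, and let $\mathbf e=\mathcal{L}^{-1}(\mathbf 1)$ be the unit tube. For real tensors let $(\mathcal A\bullet\mathcal B)(i,j,:)=\sum_s\mathcal A(i,s,:)\bullet\mathcal B(s,j,:)$, let $\mathcal A^\dagger$ be the tensor with $\mathcal{L}(\mathcal A^\dagger)(j,i,k)=\overline{\mathcal{L}(\mathcal A)(i,j,k)}$, where $\mathcal{L}$ is applied tube by tube, and let the identity tensor have $\mathbf e$ on the diagonal and zeros elsewhere; a square tensor is invertible if it has a two-sided $\bullet$-inverse. $\|\cdot\|_F$ is the Frobenius norm, and for $\mathcal X\in\mathbb R^{n_1\times1\times n_3}$, $\|\mathcal X\|_{\infty^*}=\max_i\|\mathcal X(i,1,:)\|_2$.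 Let $n_2\ge1$ and let $\mathcal U\in\mathbb R^{n_1\times n_2\times n_3}$ be such that $\mathcal U^\dagger\bullet\mathcal U$ is invertible (for example $\mathcal U^\dagger\bullet\mathcal U=\mathcal I$). Let $\mathcal S=\{\sum_j \mathcal U(:,j,:)\bullet\mathbf c_j\}$, with $\mathbf c_1,\dots,\mathbf c_{n_2}$ ranging over all real tubes, be the $n_2$-dimensional tensor-column subspace spanned by the columns of $\mathcal U$, let $\mathcal S^\perp$ be its orthogonal complement in $\mathbb R^{n_1\times1\times n_3}$, let $\mathcal P=\mathcal U\bullet(\mathcal U^\dagger\bullet\mathcal U)^{-1}\bullet\mathcal U^\dagger$, and let $\mu(\mathcal S)=\frac{n_1}{n_2}\max_{1\le j\le n_1}\|\mathcal P\bullet\mathcal E_j\|_F^2$ be the coherence of $\mathcal S$, where $\mathcal E_j\in\mathbb R^{n_1\times1\times n_3}$ has $\mathcal E_j(j,1,:)=\mathbf e$ and zeros elsewhere. Let $\mathcal T=\mathcal X+\mathcal Y\in\mathbb R^{n_1\times1\times n_3}$ with $\mathcal X\in\mathcal S$ and $\mathcal Y\in\mathcal S^\perp$. Let $\Omega=(\Omega(1),\dots,\Omega(m))$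 be drawn independently and uniformly, with replacement, from $\{1,\dots,n_1\}$, and put $\mathcal T_\Omega(i,:,:)=\mathcal T(\Omega(i),:,:)$, $\mathcal U_\Omega(i,:,:)=\mathcal U(\Omega(i),:,:)$ and $\mathcal P_\Omega=\mathcal U_\Omega\bullet(\mathcal U_\Omega^\dagger\bullet\mathcal U_\Omega)^{-1}\bullet\mathcal U_\Omega^\dagger$. Let $\delta>0$ and $m\ge\frac83 n_2\mu(\mathcal S)\log\left(\frac{2n_2n_3}{\delta}\right)$, and put $$\alpha=\sqrt{\frac{2(n_1\|\mathcal Y\|_{\infty^*}^2-\|\mathcal Y\|_F^2)}{m\|\mathcal Y\|_F^2}\log\left(\frac1\delta\right)}+\frac{2(n_1\|\mathcal Y\|_{\infty^*}^2-\|\mathcal Y\|_F^2)}{3m\|\mathcal Y\|_F^2}\log\left(\frac1\delta\right),$$ $$\beta=\left(1+2\sqrt{\log\left(\tfrac1\delta\right)}\right)^2,\qquad \gamma=\sqrt{\frac{8n_3n_2\mu(\mathcal S)}{3m}\log\left(\frac{2n_2n_3}{\delta}\right)},$$ where $\alpha$ is read as $0$ if $\mathcal Y=0$. Assume $\gamma<1$.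 Then, with probability at least $1-4\delta$, the tensor $\mathcal U_\Omega^\dagger\bullet\mathcal U_\Omega$ is invertible (so that $\mathcal P_\Omega$ is defined) and $$\frac{m(1-\alpha)-n_3n_2\mu(\mathcal S)\frac{\beta}{1-\gamma}}{n_1}\,\|\mathcal T-\mathcal P\bullet\mathcal T\|_F^2\le\|\mathcal T_\Omega-\mathcal P_\Omega\bullet\mathcal T_\Omega\|_F^2\le(1+\alpha)\frac m{n_1}\,\|\mathcal T-\mathcal P\bullet\mathcal T\|_F^2 .$$ -/

import Mathlib

noncomputable section

namespace TensorDFT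

/-- A tube of length `n₃`; entries are indexed by `0, …, n₃ - 1`. -/
abbrev Tube (n₃ : ℕ) : Type := ZMod n₃ → ℝ

/-- A real third-order tensor of size `n₁ × n₂ × n₃`, viewed as a matrix of tubes. -/
abbrev Tensor (n₁ n₂ n₃ : ℕ) : Type := Fin n₁ → Fin n₂ → Tube n₃

variable {n₁ n₂ n₄ n₃ : ℕ} [NeZero n₃]

/-- The (unnormalized) discrete Fourier transform of a real tube. -/
def tubeDFT (a : Tube n₃) : ZMod n₃ → ℂ := ZMod.dft (fun k => (a k : ℂ))

/-- The inverse discrete Fourier transform, as a real tube. It is only applied to transforms of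
real tubes, where the inverse transform has no imaginary part (`tubeDFT_invDFT`). -/
def invDFT (g : ZMod n₃ → ℂ) : Tube n₃ := fun k => (ZMod.dft.symm g k).re

/-- Tube multiplication `a • b = L⁻¹ (L a ∘ L b)`. -/
def tubeMul (a b : Tube n₃) : Tube n₃ := invDFT (fun k => tubeDFT a k * tubeDFT b k)

/-- The multiplicative unit tube `e = L⁻¹ (1)`. -/
def tubeOne : Tube n₃ := invDFT (fun _ => 1)

/-- The tensor `L`-product, `C(i,j,:) = ∑ₛ A(i,s,:) • B(s,j,:)`. -/
def lprod (A : Tensor n₁ n₂ n₃) (B : Tensor n₂ n₄ n₃) : Tensor n₁ n₄ n₃ :=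
  fun i j => ∑ s, tubeMul (A i s) (B s j)

/-- The tensor transpose: each frontal slice in the transform domain is conjugate-transposed. -/
def ltranspose (A : Tensor n₁ n₂ n₃) : Tensor n₂ n₁ n₃ :=
  fun i j => invDFT (fun k => star (tubeDFT (A j i) k))

/-- The identity tensor. -/
def lone (n n₃ : ℕ) [NeZero n₃] : Tensor n n n₃ := fun i j => if i = j then tubeOne else 0

/-- `C` is a two-sided inverse of the square tensor `B`. -/
def IsInverse {n : ℕ} (B C : Tensor n n n₃) : Prop :=
  lprod B C = lone n n₃ ∧ lprod C B = lone n n₃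

/-- Invertibility of a square tensor. -/
def IsInvertible {n : ℕ} (B : Tensor n n n₃) : Prop := ∃ C, IsInverse B C

open Classical in
/-- The inverse of an invertible square tensor (and `0` if there is none). -/
def linv {n : ℕ} (B : Tensor n n n₃) : Tensor n n n₃ :=
  if h : IsInvertible B then h.choose else 0

/-- The projection `U • (U† • U)⁻¹ • U†`. -/
def proj (U : Tensor n₁ n₂ n₃) : Tensor n₁ n₁ n₃ :=
  lprod (lprod U (linv (lprod (ltranspose U) U))) (ltranspose U)

/-- The `j`-th tensor column (lateral slice) of a tensor. -/
def column (A : Tensor n₁ n₂ n₃) (j : Fin n₂) : Tensor n₁ 1 n₃ := fun i _ => A i j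

/-- The tensor-column subspace spanned by the columns of `A`. -/
def columnSpace (A : Tensor n₁ n₂ n₃) : Set (Tensor n₁ 1 n₃) :=
  {X | ∃ c : Fin n₂ → Tensor 1 1 n₃, X = ∑ j, lprod (column A j) (c j)}

/-- The orthogonal complement for the standard (entrywise) inner product. -/
def orthComplement (S : Set (Tensor n₁ 1 n₃)) : Set (Tensor n₁ 1 n₃) :=
  {Y | ∀ X ∈ S, ∑ i, ∑ k, X i 0 k * Y i 0 k = 0}

/-- The Frobenius norm. -/
def frobNorm (A : Tensor n₁ n₂ n₃) : ℝ := √(∑ i, ∑ j, ∑ k, A i j k ^ 2)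

/-- The `ℓ_{∞*}` norm of a tensor column: the largest `ℓ₂` norm of its tubes. -/
def inftyStarNorm (X : Tensor n₁ 1 n₃) : ℝ := ⨆ i, √(∑ k, X i 0 k ^ 2)

/-- The tensor basis column `E_j`: the unit tube in position `j` and zeros elsewhere. -/
def basisColumn (j : Fin n₁) : Tensor n₁ 1 n₃ := fun i _ => if i = j then tubeOne else 0

/-- The coherence of the `n₂`-dimensional subspace spanned by the columns of `U`. -/
def coherence (U : Tensor n₁ n₂ n₃) : ℝ :=
  (n₁ : ℝ) / n₂ * ⨆ j : Fin n₁, frobNorm (lprod (proj U) (basisColumn j)) ^ 2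

/-- Tubal sampling: the tensor made of the horizontal slices listed by `ω`. -/
def sample {m : ℕ} (ω : Fin m → Fin n₁) (A : Tensor n₁ n₂ n₃) : Tensor m n₂ n₃ :=
  fun i => A (ω i)

/-! Taking real parts in `invDFT` loses nothing on transforms with conjugate symmetry. -/

theorem tubeDFT_neg (a : Tube n₃) (k : ZMod n₃) : tubeDFT a (-k) = star (tubeDFT a k) := by
  simp only [tubeDFT, ZMod.dft_apply, smul_eq_mul, star_sum, star_mul']
  refine Finset.sum_congr rfl fun j _ => ?_
  have h : ∀ z : ZMod n₃, star (ZMod.stdAddChar z) = ZMod.stdAddChar (-z) := fun z => by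
    rw [AddChar.map_neg_eq_conj]; rfl
  rw [h]
  simp

theorem tubeDFT_invDFT (g : ZMod n₃ → ℂ) (hg : ∀ k, g (-k) = star (g k)) :
    tubeDFT (invDFT g) = g := by
  have key : ∀ k, star (ZMod.dft.symm g k) = ZMod.dft.symm g k := by
    intro k
    have h : ∀ z : ZMod n₃, star (ZMod.stdAddChar z) = ZMod.stdAddChar (-z) := fun z => by
      rw [AddChar.map_neg_eq_conj]; rfl
    simp only [ZMod.invDFT_apply, smul_eq_mul, star_mul', star_sum, h]
    congr 1
    · simp
    · rw [← Equiv.sum_comp (Equiv.neg (ZMod n₃))]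
      refine Finset.sum_congr rfl fun j _ => ?_
      simp [hg]
  have : (fun k => ((invDFT g k : ℝ) : ℂ)) = ZMod.dft.symm g := by
    funext k
    exact Complex.conj_eq_iff_re.mp (key k)
  rw [tubeDFT, this, LinearEquiv.apply_symm_apply]

theorem tubeDFT_tubeMul (a b : Tube n₃) (k : ZMod n₃) :
    tubeDFT (tubeMul a b) k = tubeDFT a k * tubeDFT b k := by
  rw [tubeMul, tubeDFT_invDFT]
  intro k
  simp only [tubeDFT_neg, star_mul']

theorem tubeDFT_tubeOne (k : ZMod n₃) : tubeDFT (tubeOne : Tube n₃) k = 1 := by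
  rw [tubeOne, tubeDFT_invDFT]
  intro k
  simp

theorem tubeDFT_ltranspose (A : Tensor n₁ n₂ n₃) (i : Fin n₂) (j : Fin n₁) (k : ZMod n₃) :
    tubeDFT (ltranspose A i j) k = star (tubeDFT (A j i) k) := by
  rw [ltranspose, tubeDFT_invDFT]
  intro k
  simp only [tubeDFT_neg]

end TensorDFT

end

open TensorDFT MeasureTheory ProbabilityTheory

/-! Tensor columns are regarded as vectors of a Euclidean space carrying mutually orthogonal slice
projections `p j`, so sampling replaces `‖v‖²` by `∑ i, ‖p (ω i) v‖²`. Parseval turns the coherence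
into one inequality, `‖P_S (p j v)‖² ≤ R ‖p j v‖²` with `n₁ R = n₃ n₂ μ(S)`. After that the DFT
plays no role, and the dimension of `S` enters only through the bound `n₂ n₃`.

The full residual is `Y`, and the sampled residual is the minimum of `∑ i, ‖p (ω i) (Y - Z)‖²` over
`Z ∈ S`. Taking `Z = 0` gives the upper bound. For the lower bound, expand the square: if sampling
keeps at least `c ‖Z‖²` on `S` and `W = ∑ i, P_S (p (ω i) Y)`, the minimum is at least `∑ i, ‖p (ω
i) Y‖² - ‖W‖² / c` (`residual_lower_bound`). The same `c > 0` makes the sampled Gram tensor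
invertible.

Four failure events remain: a small eigenvalue of the sampled compressions to `S` (probability at
most `δ/2`, `IsBoundedFrame.freq_lt_le_half`), the upper and lower tails of `∑ i, ‖p (ω i) Y‖²`
(each `δ`, scalar Bernstein), and a large `‖W‖` (`δ`, `freq_norm_sum_projection_gt_le`). Since `Y ⟂
S`, the summands of `W` are centred.

The eigenvalue bound iterates a one-step estimate for the trace of an exponential, proved by
comparing two eigenbases. The bound on `‖W‖` is a Doob-type argument for Lipschitz functions of
independent draws. Two constants need care. The lower tail has a linear term absent from `α`, which
the slack in `β` absorbs. Bernstein for `W` needs a range condition, which holds whenever the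
claimed lower bound is positive. -/

namespace TubalSampling

open scoped BigOperators InnerProductSpace

/-! ### Scalar exponential inequalities and the Bernstein rate. -/

section Scalar

theorem exp_mul_quadratic_le {x : ℝ} (hx : 0 ≤ x) (hx3 : x < 3) :
    Real.exp x ≤ 1 + x + x ^ 2 / (2 * (1 - x / 3)) := by
  have key : Real.exp x * (6 - 2 * x) ≤ 6 + 4 * x + x ^ 2 := by
    -- The inequality divided by `exp x`. It is an equality at `0`, and the derivative is
    -- nonnegative because `1 + y + y²/2 ≤ exp y`.
    let h : ℝ → ℝ := fun x => (6 + 4 * x + x ^ 2) * Real.exp (-x) + 2 * x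
    have hd : ∀ y, HasDerivAt h (2 - (2 + 2 * y + y ^ 2) * Real.exp (-y)) y := by
      intro y
      have h1 : HasDerivAt (fun x : ℝ => 6 + 4 * x + x ^ 2) (4 + 2 * y) y := by
        have := (((hasDerivAt_id y).const_mul 4).const_add 6).add ((hasDerivAt_id y).pow 2)
        refine this.congr_deriv ?_
        simp
      have h2 : HasDerivAt (fun x : ℝ => Real.exp (-x)) (-Real.exp (-y)) y := by
        simpa using (hasDerivAt_neg y).exp
      have h3 := (h1.mul h2).add ((hasDerivAt_id y).const_mul 2)
      refine h3.congr_deriv ?_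
      simp
      ring
    have hmono : MonotoneOn h (Set.Ici 0) := by
      refine monotoneOn_of_deriv_nonneg (convex_Ici 0)
        (fun y _ => (hd y).continuousAt.continuousWithinAt)
        (fun y _ => (hd y).differentiableAt.differentiableWithinAt) ?_
      intro y hy
      rw [interior_Ici] at hy
      rw [(hd y).deriv, Real.exp_neg]
      have := Real.quadratic_le_exp_of_nonneg (le_of_lt hy)
      rw [sub_nonneg, mul_inv_le_iff₀ (Real.exp_pos y)]
      linarith
    have := hmono (Set.mem_Ici.2 le_rfl) (Set.mem_Ici.2 hx) hx
    simp only [h, neg_zero, Real.exp_zero] at this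
    have h4 : 6 - 2 * x ≤ (6 + 4 * x + x ^ 2) * Real.exp (-x) := by linarith
    rw [Real.exp_neg, ← div_eq_mul_inv, le_div_iff₀ (Real.exp_pos x)] at h4
    linarith
  have h0 : 0 < 6 - 2 * x := by linarith
  have : 1 + x + x ^ 2 / (2 * (1 - x / 3)) = (6 + 4 * x + x ^ 2) / (6 - 2 * x) := by
    have h1 : 2 * (1 - x / 3) = (6 - 2 * x) / 3 := by ring
    rw [h1, eq_div_iff h0.ne', add_mul, div_div_eq_mul_div, div_mul_cancel₀ _ h0.ne']
    ring
  rw [this, le_div_iff₀ h0]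
  exact key

theorem exp_neg_le_quadratic {x : ℝ} (hx : 0 ≤ x) :
    Real.exp (-x) ≤ 1 - x + x ^ 2 / 2 := by
  let h : ℝ → ℝ := fun x => 1 - x + x ^ 2 / 2 - Real.exp (-x)
  have hd : ∀ y, HasDerivAt h (-1 + y + Real.exp (-y)) y := by
    intro y
    have h2 : HasDerivAt (fun x : ℝ => Real.exp (-x)) (-Real.exp (-y)) y := by
      simpa using (hasDerivAt_neg y).exp
    have h3 := (((hasDerivAt_id y).const_sub 1).add (((hasDerivAt_id y).pow 2).div_const 2)).sub h2
    refine h3.congr_deriv ?_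
    simp
  have hmono : MonotoneOn h (Set.Ici 0) := by
    refine monotoneOn_of_deriv_nonneg (convex_Ici 0)
      (fun y _ => (hd y).continuousAt.continuousWithinAt)
      (fun y _ => (hd y).differentiableAt.differentiableWithinAt) ?_
    intro y hy
    rw [(hd y).deriv]
    linarith [Real.add_one_le_exp (-y)]
  have := hmono (Set.mem_Ici.2 le_rfl) (Set.mem_Ici.2 hx) hx
  simp only [h, neg_zero, Real.exp_zero] at this
  linarith

/-- Only an upper bound on `x` is needed: for negative `x` the plain quadratic bound is already
stronger. This is what makes the Bernstein bounds below one-sided in the range. -/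
theorem exp_le_quadratic_of_le {x B : ℝ} (hB : 0 ≤ B) (hB3 : B < 3) (hx : x ≤ B) :
    Real.exp x ≤ 1 + x + x ^ 2 / (2 * (1 - B / 3)) := by
  rcases le_total 0 x with h | h
  · refine (exp_mul_quadratic_le h (by linarith)).trans ?_
    have : 0 < 2 * (1 - B / 3) := by linarith
    gcongr
  · have h1 := exp_neg_le_quadratic (neg_nonneg.2 h)
    rw [neg_neg] at h1
    have : x ^ 2 / 2 ≤ x ^ 2 / (2 * (1 - B / 3)) := by
      have : 0 < 2 * (1 - B / 3) := by linarith
      gcongr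
      linarith
    nlinarith

/-- The scalar inequality behind the trace inequality for rank-one-like perturbations. -/
theorem exp_neg_sub_one_add_le (x : ℝ) :
    Real.exp (-x) - 1 + x ≤ x ^ 2 / 2 + x ^ 2 * Real.exp (-x) / 6 := by
  rcases le_total 0 x with h | h
  · have h1 := exp_neg_le_quadratic h
    have : 0 ≤ x ^ 2 * Real.exp (-x) / 6 := by positivity
    linarith
  · obtain ⟨y, rfl⟩ : ∃ y, x = -y := ⟨-x, by simp⟩
    have hy : 0 ≤ y := by linarith
    rw [neg_neg]
    -- For `x = -y` the claim multiplied by `exp (-y)` reads `1 ≤ h y`. Equality holds at `0`, and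
    -- `h` increases because `3y/2 ≤ exp y`.
    let h : ℝ → ℝ := fun y => (1 + y + y ^ 2 / 2) * Real.exp (-y) + y ^ 2 / 6
    have hd : ∀ y, HasDerivAt h (-(y ^ 2 / 2) * Real.exp (-y) + y / 3) y := by
      intro y
      have h1 : HasDerivAt (fun x : ℝ => 1 + x + x ^ 2 / 2) (1 + y) y := by
        have := (((hasDerivAt_id y)).const_add 1).add (((hasDerivAt_id y).pow 2).div_const 2)
        refine this.congr_deriv ?_
        simp
      have h2 : HasDerivAt (fun x : ℝ => Real.exp (-x)) (-Real.exp (-y)) y := by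
        simpa using (hasDerivAt_neg y).exp
      have h3 := (h1.mul h2).add (((hasDerivAt_id y).pow 2).div_const 6)
      refine h3.congr_deriv ?_
      simp
      ring
    have hmono : MonotoneOn h (Set.Ici 0) := by
      refine monotoneOn_of_deriv_nonneg (convex_Ici 0)
        (fun y _ => (hd y).continuousAt.continuousWithinAt)
        (fun y _ => (hd y).differentiableAt.differentiableWithinAt) ?_
      intro y hy
      rw [interior_Ici] at hy
      have hy : 0 < y := hy
      rw [(hd y).deriv, Real.exp_neg]
      have := Real.quadratic_le_exp_of_nonneg hy.le
      have h5 : y ^ 2 / 2 * (Real.exp y)⁻¹ ≤ y / 3 := by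
        rw [mul_inv_le_iff₀ (Real.exp_pos y)]
        nlinarith [mul_pos hy hy, mul_nonneg hy.le (sq_nonneg (y - 1 / 2))]
      linarith
    have := hmono (Set.mem_Ici.2 le_rfl) (Set.mem_Ici.2 hy) hy
    simp only [h, neg_zero, Real.exp_zero] at this
    have h6 : Real.exp y * Real.exp (-y) = 1 := by rw [← Real.exp_add]; simp
    have h7 := mul_le_mul_of_nonneg_left this (Real.exp_pos y).le
    have h8 : Real.exp y * ((1 + y + y ^ 2 / 2) * Real.exp (-y) + y ^ 2 / 6)
        = (1 + y + y ^ 2 / 2) + y ^ 2 * Real.exp y / 6 := by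
      linear_combination (1 + y + y ^ 2 / 2) * h6
    rw [h8] at h7
    linarith

theorem exists_bernstein_rate {v b t l : ℝ} (hv : 0 < v) (hb : 0 ≤ b) (ht : 0 ≤ t)
    (h : 2 * l * (v + b * t / 3) ≤ t ^ 2) :
    ∃ θ : ℝ, 0 ≤ θ ∧ θ * b < 3 ∧ θ ^ 2 * v / (2 * (1 - θ * b / 3)) - θ * t ≤ -l := by
  have hw : 0 < v + b * t / 3 := by positivity
  -- The classical Bernstein choice of `θ`, for which `1 - θ b / 3 = v / (v + b t / 3)`.
  refine ⟨t / (v + b * t / 3), by positivity, ?_, ?_⟩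
  · rw [div_mul_eq_mul_div, div_lt_iff₀ hw]
    nlinarith
  · set w := v + b * t / 3 with hwdef
    have h1 : 1 - t / w * b / 3 = v / w := by
      field_simp
      rw [hwdef]; ring
    rw [h1]
    have h2 : (t / w) ^ 2 * v / (2 * (v / w)) - t / w * t = -(t ^ 2 / (2 * w)) := by
      field_simp
      ring
    rw [h2, neg_le_neg_iff, le_div_iff₀ (by positivity)]
    linarith

end Scalar

/-! ### Uniform averages, moment generating functions and scalar Bernstein. -/

section Averages

variable {ι α : Type*} [Fintype ι] [Fintype α]

theorem expect_cons {m : ℕ} (f : (Fin (m + 1) → ι) → ℝ) :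
    𝔼 ω, f ω = 𝔼 j, 𝔼 ω : Fin m → ι, f (Fin.cons j ω) := by
  rw [← Finset.expect_product', Finset.univ_product_univ]
  exact (Fintype.expect_equiv (Fin.consEquiv fun _ => ι) _ _ fun _ => rfl).symm

open Classical in
/-- The relative frequency of a predicate on a finite type. -/
noncomputable def freq (p : α → Prop) : ℝ := 𝔼 a, if p a then 1 else 0

/-- Markov's inequality in the form used by every Chernoff argument below. -/
theorem freq_le_expect {p : α → Prop} {f : α → ℝ} (h0 : ∀ a, 0 ≤ f a)
    (h1 : ∀ a, p a → 1 ≤ f a) : freq p ≤ 𝔼 a, f a := by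
  refine Finset.expect_le_expect fun a _ => ?_
  split_ifs with h
  · exact h1 a h
  · exact h0 a

/-- One-step moment generating function bound. -/
theorem expect_exp_le [Nonempty ι] {Z : ι → ℝ} {b V θ : ℝ} (hb0 : 0 ≤ b)
    (hZ : 𝔼 j, Z j = 0) (hb : ∀ j, Z j ≤ b) (hV : 𝔼 j, Z j ^ 2 ≤ V) (hθ : 0 ≤ θ)
    (hθb : θ * b < 3) :
    𝔼 j, Real.exp (θ * Z j) ≤ Real.exp (θ ^ 2 * V / (2 * (1 - θ * b / 3))) := by
  have hpos : 0 < 2 * (1 - θ * b / 3) := by linarith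
  calc 𝔼 j, Real.exp (θ * Z j)
      ≤ 𝔼 j, (1 + θ * Z j + θ ^ 2 / (2 * (1 - θ * b / 3)) * Z j ^ 2) := by
        refine Finset.expect_le_expect fun j _ => ?_
        have := exp_le_quadratic_of_le (mul_nonneg hθ hb0) hθb
          (mul_le_mul_of_nonneg_left (hb j) hθ)
        calc _ ≤ _ := this
          _ = _ := by ring
    _ = 1 + θ ^ 2 / (2 * (1 - θ * b / 3)) * 𝔼 j, Z j ^ 2 := by
        rw [Finset.expect_add_distrib, Finset.expect_add_distrib, ← Finset.mul_expect,
          ← Finset.mul_expect, hZ, Fintype.expect_const]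
        ring
    _ ≤ 1 + θ ^ 2 / (2 * (1 - θ * b / 3)) * V := by gcongr
    _ = θ ^ 2 * V / (2 * (1 - θ * b / 3)) + 1 := by ring
    _ ≤ _ := Real.add_one_le_exp _

theorem expect_exp_sum (Z : ι → ℝ) (θ : ℝ) (m : ℕ) :
    𝔼 ω : Fin m → ι, Real.exp (θ * ∑ i, Z (ω i)) = (𝔼 j, Real.exp (θ * Z j)) ^ m := by
  induction m with
  | zero => simp
  | succ m ih =>
    rw [expect_cons]
    simp only [Fin.sum_univ_succ, Fin.cons_zero, Fin.cons_succ, mul_add, Real.exp_add]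
    simp_rw [← Finset.mul_expect, ih, ← Finset.expect_mul]
    ring

/-- Bernstein's inequality for sums of independent uniform draws, with a one-sided range bound. -/
theorem freq_sum_gt_le [Nonempty ι] {Z : ι → ℝ} {b V t l : ℝ} {m : ℕ} (hb0 : 0 ≤ b)
    (hZ : 𝔼 j, Z j = 0) (hb : ∀ j, Z j ≤ b) (hV : 𝔼 j, Z j ^ 2 ≤ V) (ht : 0 ≤ t)
    (hm : 0 < m) (h : 2 * l * (m * V + b * t / 3) ≤ t ^ 2) :
    freq (fun ω : Fin m → ι => t < ∑ i, Z (ω i)) ≤ Real.exp (-l) := by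
  have hV0 : 0 ≤ V := le_trans (Finset.expect_nonneg fun j _ => sq_nonneg _) hV
  have hm' : (0 : ℝ) < m := by exact_mod_cast hm
  -- The rate lemma needs positive variance; with `V = 0` every `Z j` vanishes and the event is
  -- empty.
  rcases hV0.eq_or_lt with hV1 | hV1
  · have hz : ∀ j, Z j = 0 := by
      have h0 : 𝔼 j, Z j ^ 2 = 0 :=
        le_antisymm (hV1 ▸ hV) (Finset.expect_nonneg fun j _ => sq_nonneg _)
      rw [Fintype.expect_eq_sum_div_card, div_eq_zero_iff] at h0
      rcases h0 with h0 | h0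
      · intro j
        have := (Finset.sum_eq_zero_iff_of_nonneg (fun j _ => sq_nonneg (Z j))).1 h0 j
          (Finset.mem_univ j)
        exact pow_eq_zero_iff (two_ne_zero) |>.1 this
      · simp at h0
    have : freq (fun ω : Fin m → ι => t < ∑ i, Z (ω i)) ≤ 𝔼 _ω : Fin m → ι, (0 : ℝ) :=
      freq_le_expect (fun _ => le_rfl) fun ω hω => by
        simp only [hz, Finset.sum_const_zero] at hω
        linarith
    refine this.trans ?_
    rw [Finset.expect_const_zero]
    positivity
  · obtain ⟨θ, hθ0, hθb, hθ⟩ := exists_bernstein_rate (mul_pos hm' hV1) hb0 ht h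
    calc freq (fun ω : Fin m → ι => t < ∑ i, Z (ω i))
        ≤ 𝔼 ω : Fin m → ι, Real.exp (-(θ * t)) * Real.exp (θ * ∑ i, Z (ω i)) := by
          refine freq_le_expect (fun _ => by positivity) fun ω hω => ?_
          rw [← Real.exp_add]
          refine Real.one_le_exp ?_
          nlinarith
      _ = Real.exp (-(θ * t)) * (𝔼 j, Real.exp (θ * Z j)) ^ m := by
          rw [← Finset.mul_expect, expect_exp_sum]
      _ ≤ Real.exp (-(θ * t)) * (Real.exp (θ ^ 2 * V / (2 * (1 - θ * b / 3)))) ^ m := by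
          gcongr
          exact expect_exp_le hb0 hZ hb hV hθ0 hθb
      _ = Real.exp (θ ^ 2 * (m * V) / (2 * (1 - θ * b / 3)) - θ * t) := by
          rw [← Real.exp_nat_mul, ← Real.exp_add]
          congr 1
          ring
      _ ≤ _ := Real.exp_le_exp.2 hθ

end Averages

/-! ### Traces of exponentials and a lower matrix Chernoff bound. -/

section Spectral

variable {E : Type*} [NormedAddCommGroup E] [InnerProductSpace ℝ E]
variable {κ κ' : Type*} [Fintype κ] [Fintype κ']

section TwoBases

variable {A B : E →ₗ[ℝ] E} {u : OrthonormalBasis κ ℝ E} {w : OrthonormalBasis κ' ℝ E}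
  {a : κ → ℝ} {b : κ' → ℝ}

theorem inner_eigenvector_sub (hB : B.IsSymmetric) (hu : ∀ i, A (u i) = a i • u i)
    (hw : ∀ j, B (w j) = b j • w j) (i : κ) (j : κ') :
    ⟪w j, (A - B) (u i)⟫_ℝ = (a i - b j) * ⟪u i, w j⟫_ℝ := by
  rw [LinearMap.sub_apply, inner_sub_right, hu, ← hB (w j) (u i), hw, real_inner_smul_right,
    real_inner_smul_left, real_inner_comm (u i) (w j)]
  ring

theorem sum_overlap_mul_sub (hB : B.IsSymmetric) (hu : ∀ i, A (u i) = a i • u i)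
    (hw : ∀ j, B (w j) = b j • w j) (i : κ) :
    ∑ j, ⟪u i, w j⟫_ℝ ^ 2 * (a i - b j) = ⟪u i, (A - B) (u i)⟫_ℝ := by
  rw [← w.sum_inner_mul_inner]
  refine Finset.sum_congr rfl fun j _ => ?_
  rw [inner_eigenvector_sub hB hu hw]
  ring

theorem sum_overlap_mul_sub_sq (hB : B.IsSymmetric) (hu : ∀ i, A (u i) = a i • u i)
    (hw : ∀ j, B (w j) = b j • w j) (i : κ) :
    ∑ j, ⟪u i, w j⟫_ℝ ^ 2 * (a i - b j) ^ 2 = ‖(A - B) (u i)‖ ^ 2 := by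
  rw [← w.sum_sq_norm_inner_right]
  refine Finset.sum_congr rfl fun j _ => ?_
  rw [inner_eigenvector_sub hB hu hw, Real.norm_eq_abs, sq_abs]
  ring

theorem sum_overlap (i : κ) : ∑ j, ⟪u i, w j⟫_ℝ ^ 2 = 1 := by
  have := w.sum_sq_norm_inner_left (u i)
  simpa [Real.norm_eq_abs, sq_abs] using this

/-- A trace inequality for `exp` under a perturbation `D = A - B` with `0 ≤ D` and `D² ≤ L D`,
expressed through eigenbases of `A` and `B`. -/
theorem sum_exp_eigenvalues_le (hA : A.IsSymmetric) (hB : B.IsSymmetric)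
    (hu : ∀ i, A (u i) = a i • u i) (hw : ∀ j, B (w j) = b j • w j) {L : ℝ} (hL : 0 ≤ L)
    (hD : ∀ v, ‖(A - B) v‖ ^ 2 ≤ L * ⟪v, (A - B) v⟫_ℝ) :
    ∑ j, Real.exp (b j) ≤ ∑ i, Real.exp (a i)
      - (1 - 2 / 3 * L) * ∑ i, Real.exp (a i) * ⟪u i, (A - B) (u i)⟫_ℝ := by
  -- Squared overlaps of the two eigenbases form a doubly stochastic array, so the traces of `exp
  -- A`, `exp B`, `exp A · D`, `exp B · D²` and so on become double sums to which scalar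
  -- inequalities apply termwise, although `A` and `B` need not commute.
  set p : κ → κ' → ℝ := fun i j => ⟪u i, w j⟫_ℝ ^ 2 with hp
  have hp0 : ∀ i j, 0 ≤ p i j := fun i j => sq_nonneg _
  have hpi : ∀ i, ∑ j, p i j = 1 := fun i => sum_overlap i
  have hsymm : ∀ i j, p i j = ⟪w j, u i⟫_ℝ ^ 2 := fun i j => by
    simp only [hp]; rw [real_inner_comm]
  have hpj : ∀ j, ∑ i, p i j = 1 := fun j => by simp_rw [hsymm]; exact sum_overlap j
  have e1 : ∑ i, ∑ j, p i j * Real.exp (a i) = ∑ i, Real.exp (a i) := by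
    simp_rw [← Finset.sum_mul, hpi, one_mul]
  have e2 : ∑ i, ∑ j, p i j * Real.exp (b j) = ∑ j, Real.exp (b j) := by
    rw [Finset.sum_comm]
    simp_rw [← Finset.sum_mul, hpj, one_mul]
  have e3 : ∑ i, ∑ j, p i j * (a i - b j) * Real.exp (a i)
      = ∑ i, Real.exp (a i) * ⟪u i, (A - B) (u i)⟫_ℝ := by
    simp_rw [← Finset.sum_mul, hp, sum_overlap_mul_sub hB hu hw, mul_comm]
  have e4 : ∑ i, ∑ j, p i j * (a i - b j) * Real.exp (b j)
      = ∑ j, Real.exp (b j) * ⟪w j, (A - B) (w j)⟫_ℝ := by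
    rw [Finset.sum_comm]
    refine Finset.sum_congr rfl fun j _ => ?_
    have h := sum_overlap_mul_sub hA hw hu j
    have h2 : ⟪w j, (A - B) (w j)⟫_ℝ = -⟪w j, (B - A) (w j)⟫_ℝ := by
      rw [← inner_neg_right, ← LinearMap.neg_apply, neg_sub]
    rw [h2, ← h, ← Finset.sum_mul, mul_comm, ← Finset.sum_neg_distrib]
    congr 1
    refine Finset.sum_congr rfl fun i _ => ?_
    rw [hsymm]; ring
  have e5 : ∑ i, ∑ j, p i j * (a i - b j) ^ 2 * Real.exp (a i)
      = ∑ i, Real.exp (a i) * ‖(A - B) (u i)‖ ^ 2 := by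
    simp_rw [← Finset.sum_mul, hp, sum_overlap_mul_sub_sq hB hu hw, mul_comm]
  have e6 : ∑ i, ∑ j, p i j * (a i - b j) ^ 2 * Real.exp (b j)
      = ∑ j, Real.exp (b j) * ‖(A - B) (w j)‖ ^ 2 := by
    rw [Finset.sum_comm]
    refine Finset.sum_congr rfl fun j _ => ?_
    have h := sum_overlap_mul_sub_sq hA hw hu j
    have h2 : ‖(A - B) (w j)‖ = ‖(B - A) (w j)‖ := by
      rw [← norm_neg, ← LinearMap.neg_apply, neg_sub]
    rw [h2, ← h, ← Finset.sum_mul, mul_comm]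
    congr 1
    refine Finset.sum_congr rfl fun i _ => ?_
    rw [hsymm]; ring
  -- Termwise this is `(a i - b j) (exp (a i) - exp (b j)) ≥ 0`.
  have hmono : ∑ j, Real.exp (b j) * ⟪w j, (A - B) (w j)⟫_ℝ
      ≤ ∑ i, Real.exp (a i) * ⟪u i, (A - B) (u i)⟫_ℝ := by
    rw [← e3, ← e4]
    refine Finset.sum_le_sum fun i _ => Finset.sum_le_sum fun j _ => ?_
    rw [mul_assoc, mul_assoc]
    refine mul_le_mul_of_nonneg_left ?_ (hp0 i j)
    rcases le_total (a i) (b j) with h | h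
    · have := Real.exp_le_exp.2 h
      nlinarith
    · have := Real.exp_le_exp.2 h
      nlinarith
  -- The scalar inequality at `x = a i - b j`, weighted by `p i j * exp (a i)`. With `D² ≤ L D` and
  -- `hmono`, the coefficients `1/2` and `1/6` add up to `2/3`.
  have hmain : ∑ i, ∑ j, p i j * Real.exp (b j) - ∑ i, ∑ j, p i j * Real.exp (a i)
      + ∑ i, ∑ j, p i j * (a i - b j) * Real.exp (a i)
      ≤ (∑ i, ∑ j, p i j * (a i - b j) ^ 2 * Real.exp (a i)) / 2
        + (∑ i, ∑ j, p i j * (a i - b j) ^ 2 * Real.exp (b j)) / 6 := by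
    simp_rw [Finset.sum_div, ← Finset.sum_sub_distrib, ← Finset.sum_add_distrib]
    refine Finset.sum_le_sum fun i _ => Finset.sum_le_sum fun j _ => ?_
    have h := exp_neg_sub_one_add_le (a i - b j)
    have h2 : Real.exp (b j) = Real.exp (a i) * Real.exp (-(a i - b j)) := by
      rw [← Real.exp_add]; ring_nf
    have h3 := mul_le_mul_of_nonneg_left h (mul_nonneg (hp0 i j) (Real.exp_pos (a i)).le)
    rw [h2]
    linarith
  have f1 : ∑ i, Real.exp (a i) * ‖(A - B) (u i)‖ ^ 2
      ≤ L * ∑ i, Real.exp (a i) * ⟪u i, (A - B) (u i)⟫_ℝ := by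
    rw [Finset.mul_sum]
    refine Finset.sum_le_sum fun i _ => ?_
    rw [mul_left_comm]
    exact mul_le_mul_of_nonneg_left (hD _) (Real.exp_pos _).le
  have f2 : ∑ j, Real.exp (b j) * ‖(A - B) (w j)‖ ^ 2
      ≤ L * ∑ j, Real.exp (b j) * ⟪w j, (A - B) (w j)⟫_ℝ := by
    rw [Finset.mul_sum]
    refine Finset.sum_le_sum fun i _ => ?_
    rw [mul_left_comm]
    exact mul_le_mul_of_nonneg_left (hD _) (Real.exp_pos _).le
  rw [e1, e2, e3, e5, e6] at hmain
  have f3 := mul_le_mul_of_nonneg_left hmono hL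
  linarith

end TwoBases

variable [FiniteDimensional ℝ E]

open Classical in
/-- The trace of the exponential of a symmetric operator (and `0` for other operators). -/
noncomputable def traceExp (A : E →ₗ[ℝ] E) : ℝ :=
  if h : A.IsSymmetric then ∑ i, Real.exp (h.eigenvalues rfl i) else 0

theorem traceExp_nonneg (A : E →ₗ[ℝ] E) : 0 ≤ traceExp A := by
  unfold traceExp
  split_ifs
  · exact Finset.sum_nonneg fun _ _ => (Real.exp_pos _).le
  · exact le_rfl

theorem traceExp_zero : traceExp (0 : E →ₗ[ℝ] E) = Module.finrank ℝ E := by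
  have h : (0 : E →ₗ[ℝ] E).IsSymmetric := LinearMap.IsSymmetric.zero
  rw [traceExp, dif_pos h]
  have h0 : ∀ i, h.eigenvalues rfl i = 0 := fun i => by
    have h1 := h.apply_eigenvectorBasis rfl i
    rw [LinearMap.zero_apply, eq_comm, smul_eq_zero] at h1
    rcases h1 with h1 | h1
    · exact_mod_cast h1
    · have := (h.eigenvectorBasis rfl).orthonormal.ne_zero i
      exact absurd h1 this
  simp [h0]

/-- A Rayleigh quotient above `t` forces an eigenvalue above `t`, and its exponential is one term of
a nonnegative sum. -/
theorem exp_le_traceExp {A : E →ₗ[ℝ] E} (hA : A.IsSymmetric) {v : E} {t : ℝ}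
    (h : t * ‖v‖ ^ 2 < ⟪v, A v⟫_ℝ) : Real.exp t ≤ traceExp A := by
  obtain ⟨i, hi⟩ : ∃ i, t < hA.eigenvalues rfl i := by
    by_contra! hcon
    refine h.not_ge ?_
    set u := hA.eigenvectorBasis rfl
    rw [← u.sum_inner_mul_inner, ← u.sum_sq_norm_inner_right, Finset.mul_sum]
    refine Finset.sum_le_sum fun i _ => ?_
    rw [← hA (u i) v, hA.apply_eigenvectorBasis, real_inner_smul_left, Real.norm_eq_abs, sq_abs,
      real_inner_comm v (u i)]
    have := mul_le_mul_of_nonneg_right (hcon i) (sq_nonneg ⟪v, u i⟫_ℝ)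
    simp only [RCLike.ofReal_real_eq_id, id_eq]
    nlinarith
  rw [traceExp, dif_pos hA]
  refine (Real.exp_le_exp.2 hi.le).trans ?_
  exact Finset.single_le_sum (f := fun i => Real.exp (hA.eigenvalues rfl i))
    (fun _ _ => (Real.exp_pos _).le) (Finset.mem_univ i)

variable {ι : Type*} [Fintype ι] [Nonempty ι]

/-- A resolution of the identity by positive operators with `D j ^ 2 ≤ R • D j`. -/
structure IsBoundedFrame (D : ι → E →ₗ[ℝ] E) (R : ℝ) : Prop where
  nonneg : 0 ≤ R
  symm : ∀ j, (D j).IsSymmetric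
  sum_inner : ∀ v, ∑ j, ⟪v, D j v⟫_ℝ = ‖v‖ ^ 2
  bound : ∀ j v, ‖D j v‖ ^ 2 ≤ R * ⟪v, D j v⟫_ℝ

variable {D : ι → E →ₗ[ℝ] E} {R : ℝ}

/-- The perturbation inequality is linear in `D j` on its right-hand side, in the fixed eigenbasis
of `A`. Averaging over `j` thus only needs `∑ j, D j = 1` as a quadratic form. -/
theorem IsBoundedFrame.expect_traceExp_sub_le (hD : IsBoundedFrame D R) {A : E →ₗ[ℝ] E}
    (hA : A.IsSymmetric) {θ : ℝ} (hθ : 0 ≤ θ) :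
    𝔼 j, traceExp (A - θ • D j)
      ≤ Real.exp (-((1 - 2 / 3 * (θ * R)) * θ / Fintype.card ι)) * traceExp A := by
  set n : ℝ := (Fintype.card ι : ℝ) with hn
  have hn0 : 0 < n := by rw [hn]; exact_mod_cast Fintype.card_pos
  set u := hA.eigenvectorBasis rfl with hu
  set c := 1 - 2 / 3 * (θ * R) with hc
  have hstep : ∀ j, traceExp (A - θ • D j) ≤ traceExp A
      - c * ∑ i, Real.exp (hA.eigenvalues rfl i) * ⟪u i, θ • D j (u i)⟫_ℝ := by
    intro j
    have hB : (A - θ • D j).IsSymmetric := hA.sub ((hD.symm j).smul (by simp))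
    have hsub : A - (A - θ • D j) = θ • D j := sub_sub_cancel _ _
    have := sum_exp_eigenvalues_le (u := u) (w := hB.eigenvectorBasis rfl) hA hB
      (fun i => hA.apply_eigenvectorBasis rfl i) (fun i => hB.apply_eigenvectorBasis rfl i)
      (mul_nonneg hθ hD.nonneg) (fun v => by
        rw [hsub, LinearMap.smul_apply, norm_smul, real_inner_smul_right, mul_pow,
          Real.norm_eq_abs, sq_abs]
        have := mul_le_mul_of_nonneg_left (hD.bound j v) (sq_nonneg θ)
        linarith)
    rw [hsub] at this
    rw [traceExp, dif_pos hB, traceExp, dif_pos hA]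
    exact this
  have hsum : 𝔼 j, ∑ i, Real.exp (hA.eigenvalues rfl i) * ⟪u i, θ • D j (u i)⟫_ℝ
      = θ / n * traceExp A := by
    rw [Fintype.expect_eq_sum_div_card, Finset.sum_comm, traceExp, dif_pos hA, Finset.mul_sum,
      Finset.sum_div]
    refine Finset.sum_congr rfl fun i _ => ?_
    simp_rw [real_inner_smul_right, ← Finset.mul_sum, hD.sum_inner, u.orthonormal.1]
    ring
  calc 𝔼 j, traceExp (A - θ • D j)
      ≤ 𝔼 j, (traceExp A
          - c * ∑ i, Real.exp (hA.eigenvalues rfl i) * ⟪u i, θ • D j (u i)⟫_ℝ) :=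
        Finset.expect_le_expect fun j _ => hstep j
    _ = (-(c * θ / n) + 1) * traceExp A := by
        rw [Finset.expect_sub_distrib, Fintype.expect_const, ← Finset.mul_expect, hsum]
        ring
    _ ≤ _ := by
        gcongr
        · exact traceExp_nonneg A
        · exact Real.add_one_le_exp _

/-- Draws are peeled off one at a time, so `A` must vary in the induction. -/
theorem IsBoundedFrame.expect_traceExp_sub_sum_le (hD : IsBoundedFrame D R) {θ : ℝ}
    (hθ : 0 ≤ θ) (m : ℕ) {A : E →ₗ[ℝ] E} (hA : A.IsSymmetric) :
    𝔼 ω : Fin m → ι, traceExp (A - θ • ∑ i, D (ω i))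
      ≤ Real.exp (-((1 - 2 / 3 * (θ * R)) * θ / Fintype.card ι)) ^ m * traceExp A := by
  set q := Real.exp (-((1 - 2 / 3 * (θ * R)) * θ / Fintype.card ι)) with hq
  induction m generalizing A with
  | zero => simp
  | succ m ih =>
    rw [expect_cons]
    calc 𝔼 j, 𝔼 ω : Fin m → ι, traceExp (A - θ • ∑ i, D ((Fin.cons j ω : Fin (m + 1) → ι) i))
        ≤ 𝔼 j, q ^ m * traceExp (A - θ • D j) := by
          refine Finset.expect_le_expect fun j _ => ?_
          refine le_trans (le_of_eq ?_) (ih (hA.sub ((hD.symm j).smul (by simp))))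
          refine Finset.expect_congr rfl fun ω _ => ?_
          rw [Fin.sum_univ_succ, smul_add, sub_sub]
          simp
      _ = q ^ m * 𝔼 j, traceExp (A - θ • D j) := by rw [Finset.mul_expect]
      _ ≤ q ^ m * (q * traceExp A) := by
          have : 0 < q := Real.exp_pos _
          gcongr
          exact hD.expect_traceExp_sub_le hA hθ
      _ = q ^ (m + 1) * traceExp A := by ring

/-- A matrix Chernoff bound for the smallest eigenvalue of a sum of uniform draws. -/
theorem IsBoundedFrame.freq_lt_le (hD : IsBoundedFrame D R) {θ : ℝ} (hθ : 0 < θ) (m : ℕ)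
    (s : ℝ) :
    freq (fun ω : Fin m → ι => ∃ v, ∑ i, ⟪v, D (ω i) v⟫_ℝ < s * ‖v‖ ^ 2)
      ≤ Module.finrank ℝ E
        * Real.exp (θ * s - (1 - 2 / 3 * (θ * R)) * θ * m / Fintype.card ι) := by
  have hsymm : ∀ ω : Fin m → ι, (-(θ • ∑ i, D (ω i)) : E →ₗ[ℝ] E).IsSymmetric := fun ω =>
    by
      have h1 : ∀ t : Finset (Fin m), (∑ i ∈ t, D (ω i)).IsSymmetric := fun t => by
        classical
        induction t using Finset.induction_on with
        | empty => simp
        | insert i t hi ih => rw [Finset.sum_insert hi]; exact (hD.symm _).add ih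
      rw [← zero_sub]
      exact LinearMap.IsSymmetric.zero.sub ((h1 _).smul (by simp))
  calc _ ≤ 𝔼 ω : Fin m → ι, Real.exp (θ * s) * traceExp (0 - θ • ∑ i, D (ω i)) := by
        refine freq_le_expect (fun ω => mul_nonneg (Real.exp_pos _).le (traceExp_nonneg _)) ?_
        rintro ω ⟨v, hv⟩
        have : Real.exp (-(θ * s)) ≤ traceExp (0 - θ • ∑ i, D (ω i)) := by
          rw [zero_sub]
          refine exp_le_traceExp (v := v) (hsymm ω) ?_
          rw [LinearMap.neg_apply, inner_neg_right, LinearMap.smul_apply, real_inner_smul_right,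
            LinearMap.sum_apply, inner_sum]
          have := mul_lt_mul_of_pos_left hv hθ
          linarith
        calc (1 : ℝ) = Real.exp (θ * s) * Real.exp (-(θ * s)) := by rw [← Real.exp_add]; simp
          _ ≤ _ := by gcongr
    _ ≤ Real.exp (θ * s) * (Real.exp (-((1 - 2 / 3 * (θ * R)) * θ / Fintype.card ι)) ^ m
          * traceExp (0 : E →ₗ[ℝ] E)) := by
        rw [← Finset.mul_expect]
        gcongr
        exact hD.expect_traceExp_sub_sum_le hθ.le m LinearMap.IsSymmetric.zero
    _ = _ := by
        rw [traceExp_zero, ← Real.exp_nat_mul, ← mul_assoc, ← Real.exp_add, mul_comm]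
        congr 2
        ring

end Spectral

/-! ### Bernstein's inequality for norms of vector sums. -/

section VectorBernstein

variable {ι α : Type*} [Fintype ι] [Nonempty ι] [Fintype α] [Nonempty α]

theorem expect_sub_expect_sq (f : α → ℝ) :
    𝔼 a, (f a - 𝔼 b, f b) ^ 2 = 𝔼 a, f a ^ 2 - (𝔼 a, f a) ^ 2 := by
  set c := 𝔼 b, f b with hc
  have : ∀ a, (f a - c) ^ 2 = f a ^ 2 - 2 * c * f a + c ^ 2 := fun a => by ring
  simp_rw [this]
  rw [Finset.expect_add_distrib, Finset.expect_sub_distrib, ← Finset.mul_expect,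
    Fintype.expect_const, ← hc]
  ring

theorem sq_expect_le (f : α → ℝ) : (𝔼 a, f a) ^ 2 ≤ 𝔼 a, f a ^ 2 := by
  have h := expect_sub_expect_sq f
  have : 0 ≤ 𝔼 a, (f a - 𝔼 b, f b) ^ 2 := Finset.expect_nonneg fun _ _ => sq_nonneg _
  linarith

theorem expect_sub_expect_sq_le (f : α → ℝ) (c : ℝ) :
    𝔼 a, (f a - 𝔼 b, f b) ^ 2 ≤ 𝔼 a, (f a - c) ^ 2 := by
  have h : 𝔼 a, (f a - c) = 𝔼 a, f a - c := by
    rw [Finset.expect_sub_distrib, Fintype.expect_const]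
  have := expect_sub_expect_sq (fun a => f a - c)
  rw [h] at this
  have h2 : ∀ a, f a - c - (𝔼 a, f a - c) = f a - 𝔼 b, f b := fun a => by ring
  simp_rw [h2] at this
  rw [this]
  linarith [sq_nonneg (𝔼 a, f a - c)]

theorem expect_sub_expect_self (f : α → ℝ) : 𝔼 a, (f a - 𝔼 b, f b) = 0 := by
  rw [Finset.expect_sub_distrib, Fintype.expect_const, sub_self]

variable {E : Type*} [NormedAddCommGroup E]

/-- A Doob martingale argument: conditioning on the first draw leaves a function of the partial sum
that is again 1-Lipschitz, so each increment obeys the scalar one-step bound. Centring of `w` plays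
no role here; it matters only when the mean of the norm is estimated. -/
theorem expect_exp_lipschitz_le {w : ι → E} {b₀ σ θ : ℝ} (hb₀ : ∀ j, ‖w j‖ ≤ b₀) (hσ : 0 ≤ σ)
    (hw : 𝔼 j, ‖w j‖ ^ 2 ≤ σ ^ 2) (hθ : 0 ≤ θ) (hθb : θ * (b₀ + σ) < 3) {h : E → ℝ}
    (hh : ∀ x y, h x - h y ≤ ‖x - y‖) (m : ℕ) (s : E) :
    𝔼 ω : Fin m → ι, Real.exp (θ * h (s + ∑ i, w (ω i)))
      ≤ Real.exp (θ * 𝔼 ω : Fin m → ι, h (s + ∑ i, w (ω i))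
          + m * (θ ^ 2 * σ ^ 2 / (2 * (1 - θ * (b₀ + σ) / 3)))) := by
  have hb0 : 0 ≤ b₀ := (norm_nonneg _).trans (hb₀ (Classical.arbitrary ι))
  have hmean : 𝔼 j, ‖w j‖ ≤ σ :=
    abs_le_of_sq_le_sq' ((sq_expect_le _).trans hw) hσ |>.2
  induction m generalizing s with
  | zero => simp
  | succ m ih =>
    set ψ := θ ^ 2 * σ ^ 2 / (2 * (1 - θ * (b₀ + σ) / 3)) with hψ
    set g : E → ℝ := fun x => 𝔼 ω : Fin m → ι, h (x + ∑ i, w (ω i)) with hg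
    have hgl : ∀ x y, g x - g y ≤ ‖x - y‖ := by
      intro x y
      simp only [hg]
      rw [← Finset.expect_sub_distrib]
      calc _ ≤ 𝔼 _ω : Fin m → ι, ‖x - y‖ :=
            Finset.expect_le_expect fun ω _ => (hh _ _).trans (by rw [add_sub_add_right_eq_sub])
        _ = _ := Fintype.expect_const _
    set Z : ι → ℝ := fun j => g (s + w j) - 𝔼 k, g (s + w k) with hZ
    have hZ0 : 𝔼 j, Z j = 0 := expect_sub_expect_self _
    -- Compare with an independent copy `w k`: its norm is averaged, hence costs only `σ`, not a
    -- second `b₀`.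
    have hZb : ∀ j, Z j ≤ b₀ + σ := by
      intro j
      have : Z j = 𝔼 k, (g (s + w j) - g (s + w k)) := by
        rw [Finset.expect_sub_distrib, Fintype.expect_const]
      rw [this]
      calc _ ≤ 𝔼 k, (b₀ + ‖w k‖) := by
            refine Finset.expect_le_expect fun k _ => (hgl _ _).trans ?_
            rw [add_sub_add_left_eq_sub]
            exact (norm_sub_le _ _).trans (by gcongr; exact hb₀ j)
        _ = b₀ + 𝔼 k, ‖w k‖ := by rw [Finset.expect_add_distrib, Fintype.expect_const]
        _ ≤ _ := by gcongr
    -- The mean minimises the second moment, so recentring at `g s` can only increase it, and there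
    -- the Lipschitz bound gives `‖w j‖²`.
    have hZV : 𝔼 j, Z j ^ 2 ≤ σ ^ 2 := by
      refine (expect_sub_expect_sq_le (fun j => g (s + w j)) (g s)).trans (le_trans ?_ hw)
      refine Finset.expect_le_expect fun j _ => ?_
      have h1 := hgl (s + w j) s
      have h2 := hgl s (s + w j)
      rw [norm_sub_rev] at h2
      rw [add_sub_cancel_left] at h1 h2
      exact sq_le_sq' (by linarith) h1
    have hmgf := expect_exp_le (add_nonneg hb0 hσ) hZ0 hZb hZV hθ hθb
    have hsplit : ∀ (F : E → ℝ), 𝔼 ω : Fin (m + 1) → ι, F (s + ∑ i, w (ω i))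
        = 𝔼 j, 𝔼 ω : Fin m → ι, F (s + w j + ∑ i, w (ω i)) := by
      intro F
      rw [expect_cons]
      refine Finset.expect_congr rfl fun j _ => Finset.expect_congr rfl fun ω _ => ?_
      rw [Fin.sum_univ_succ, ← add_assoc]
      simp
    rw [hsplit (fun x => Real.exp (θ * h x)), hsplit h]
    calc _ ≤ 𝔼 j, Real.exp (θ * g (s + w j) + m * ψ) :=
          Finset.expect_le_expect fun j _ => ih _
      _ = Real.exp (θ * 𝔼 j, g (s + w j) + m * ψ) * 𝔼 j, Real.exp (θ * Z j) := by
          rw [Finset.mul_expect]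
          refine Finset.expect_congr rfl fun j _ => ?_
          rw [← Real.exp_add]
          congr 1
          simp only [hZ]; ring
      _ ≤ Real.exp (θ * 𝔼 j, g (s + w j) + m * ψ) * Real.exp ψ := by gcongr
      _ = _ := by
          rw [← Real.exp_add]
          congr 1
          push_cast
          ring

variable [InnerProductSpace ℝ E]

/-- Cross terms vanish since the `w j` sum to zero. -/
theorem expect_norm_sq_add_sum {w : ι → E} (hw : ∑ j, w j = 0) (m : ℕ) (s : E) :
    𝔼 ω : Fin m → ι, ‖s + ∑ i, w (ω i)‖ ^ 2 = ‖s‖ ^ 2 + m * 𝔼 j, ‖w j‖ ^ 2 := by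
  induction m generalizing s with
  | zero => simp
  | succ m ih =>
    rw [expect_cons]
    have h1 : ∀ j, 𝔼 ω : Fin m → ι, ‖s + ∑ i, w ((Fin.cons j ω : Fin (m + 1) → ι) i)‖ ^ 2
        = ‖s + w j‖ ^ 2 + m * 𝔼 j, ‖w j‖ ^ 2 := by
      intro j
      rw [← ih]
      refine Finset.expect_congr rfl fun ω _ => ?_
      rw [Fin.sum_univ_succ, ← add_assoc]
      simp
    simp_rw [h1, norm_add_sq_real]
    rw [Finset.expect_add_distrib, Finset.expect_add_distrib, Finset.expect_add_distrib,
      Fintype.expect_const, Fintype.expect_const, ← Finset.mul_expect]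
    have h2 : 𝔼 j, ⟪s, w j⟫_ℝ = 0 := by
      rw [Fintype.expect_eq_sum_div_card, ← inner_sum, hw]
      simp
    rw [h2]
    push_cast
    ring

/-- A Bernstein inequality for the norm of a sum of centred vectors drawn uniformly. -/
theorem freq_norm_sum_gt_le {w : ι → E} {b₀ σ t l : ℝ} {m : ℕ} (hb₀ : ∀ j, ‖w j‖ ≤ b₀)
    (hσ : 0 < σ) (hw0 : ∑ j, w j = 0) (hw : 𝔼 j, ‖w j‖ ^ 2 ≤ σ ^ 2) (ht : 0 ≤ t) (hm : 0 < m)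
    (h : 2 * l * (m * σ ^ 2 + (b₀ + σ) * t / 3) ≤ t ^ 2) :
    freq (fun ω : Fin m → ι => √m * σ + t < ‖∑ i, w (ω i)‖) ≤ Real.exp (-l) := by
  have hb0 : 0 ≤ b₀ := (norm_nonneg _).trans (hb₀ (Classical.arbitrary ι))
  have hm' : (0 : ℝ) < m := by exact_mod_cast hm
  obtain ⟨θ, hθ0, hθb, hθ⟩ := exists_bernstein_rate (mul_pos hm' (pow_pos hσ 2))
    (add_nonneg hb0 hσ.le) ht h
  have hmean : 𝔼 ω : Fin m → ι, ‖∑ i, w (ω i)‖ ≤ √m * σ := by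
    have h1 := expect_norm_sq_add_sum hw0 m (0 : E)
    simp only [zero_add, norm_zero] at h1
    refine abs_le_of_sq_le_sq' ((sq_expect_le _).trans ?_) (by positivity) |>.2
    rw [h1, mul_pow, Real.sq_sqrt hm'.le]
    have := mul_le_mul_of_nonneg_left hw hm'.le
    linarith
  have hmgf := expect_exp_lipschitz_le hb₀ hσ.le hw hθ0 hθb (h := fun x => ‖x‖)
    (fun x y => norm_sub_norm_le x y) m 0
  simp only [zero_add] at hmgf
  calc freq (fun ω : Fin m → ι => √m * σ + t < ‖∑ i, w (ω i)‖)
      ≤ 𝔼 ω : Fin m → ι, Real.exp (-(θ * (√m * σ + t))) * Real.exp (θ * ‖∑ i, w (ω i)‖) := by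
        refine freq_le_expect (fun _ => by positivity) fun ω hω => ?_
        rw [← Real.exp_add]
        refine Real.one_le_exp ?_
        nlinarith
    _ ≤ Real.exp (-(θ * (√m * σ + t))) * Real.exp (θ * (√m * σ)
          + m * (θ ^ 2 * σ ^ 2 / (2 * (1 - θ * (b₀ + σ) / 3)))) := by
        rw [← Finset.mul_expect]
        gcongr
        refine hmgf.trans ?_
        gcongr
    _ = Real.exp (θ ^ 2 * (m * σ ^ 2) / (2 * (1 - θ * (b₀ + σ) / 3)) - θ * t) := by
        rw [← Real.exp_add]
        congr 1
        ring
    _ ≤ _ := Real.exp_le_exp.2 hθ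

end VectorBernstein

/-! ### From probabilities to relative frequencies. -/

section UniformSampling

variable {n m : ℕ} {Ξ : Type*} [MeasurableSpace Ξ] {Pr : Measure Ξ} [IsProbabilityMeasure Pr]
  {Ω : Fin m → Ξ → Fin n}

/-- The probability of an event about independent uniform draws is its relative frequency. -/
theorem measureReal_eq_freq [Nonempty (Fin n)] (hmeas : ∀ i, Measurable (Ω i))
    (hindep : iIndepFun Ω Pr) (hunif : ∀ i j, Pr.real {ξ | Ω i ξ = j} = 1 / n)
    (p : (Fin m → Fin n) → Prop) :
    Pr.real {ξ | p (fun i => Ω i ξ)} = freq p := by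
  classical
  have hX : Measurable fun ξ i => Ω i ξ := measurable_pi_lambda _ hmeas
  have hmap := (iIndepFun_iff_map_fun_eq_pi_map (fun i => (hmeas i).aemeasurable)).1 hindep
  have : IsProbabilityMeasure (Pr.map fun ξ i => Ω i ξ) :=
    Measure.isProbabilityMeasure_map hX.aemeasurable
  have h1 : Pr.real {ξ | p (fun i => Ω i ξ)} = (Pr.map fun ξ i => Ω i ξ).real {ω | p ω} := by
    rw [map_measureReal_apply hX (Set.toFinite _).measurableSet]
    rfl
  have h2 : ∀ ω, (Pr.map fun ξ i => Ω i ξ).real {ω} = (1 / (n : ℝ)) ^ m := by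
    intro ω
    rw [measureReal_def, hmap, Measure.pi_singleton, ENNReal.toReal_prod]
    have h3 : ∀ i, (Pr.map (Ω i) {ω i}).toReal = 1 / n := fun i => by
      rw [Measure.map_apply (hmeas i) (measurableSet_singleton _), ← hunif i (ω i)]
      rfl
    simp [h3]
  have h4 : {ω | p ω} = ↑(Finset.univ.filter p) := by ext; simp
  rw [h1, h4, ← sum_measureReal_singleton, freq, Fintype.expect_eq_sum_div_card,
    Finset.sum_congr rfl fun ω _ => h2 ω]
  rw [Finset.sum_const, nsmul_eq_mul, Finset.sum_boole, Fintype.card_fun, Fintype.card_fin,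
    Fintype.card_fin]
  push_cast
  rw [one_div, inv_pow, div_eq_mul_inv]

end UniformSampling

theorem freq_le_add {α : Type*} [Fintype α] {p q r : α → Prop} (h : ∀ a, p a → q a ∨ r a) :
    freq p ≤ freq q + freq r := by
  classical
  unfold freq
  rw [← Finset.expect_add_distrib]
  refine Finset.expect_le_expect fun a _ => ?_
  have := h a
  by_cases hp : p a <;> by_cases hq : q a <;> by_cases hr : r a <;> simp_all

theorem freq_eq_zero {α : Type*} [Fintype α] {p : α → Prop} (h : ∀ a, ¬ p a) : freq p = 0 := by
  classical
  simp [freq, h]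

/-! ### Two-sided tails for sums of bounded nonnegative values. -/

section Tails

variable {ι : Type*} [Fintype ι] [Nonempty ι]

theorem bernstein_threshold {v b l : ℝ} (hv : 0 ≤ v) (hb : 0 ≤ b) (hl : 0 ≤ l) :
    2 * l * (v + b * (√(2 * v * l) + 2 / 3 * b * l) / 3) ≤ (√(2 * v * l) + 2 / 3 * b * l) ^ 2 := by
  have h := Real.sq_sqrt (show 0 ≤ 2 * v * l by positivity)
  have h2 : 0 ≤ b * l * √(2 * v * l) := by positivity
  nlinarith

/-- From `y² ≤ M y` on `[0, M]`; this variance bound is the source of the factor `n₁‖Y‖²_{∞*} -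
‖Y‖²_F` in `α`. -/
theorem expect_sub_expect_sq_le_of_le {y : ι → ℝ} {M : ℝ} (hy : ∀ j, 0 ≤ y j) (hM : ∀ j, y j ≤ M) :
    𝔼 j, (y j - 𝔼 k, y k) ^ 2 ≤ (𝔼 k, y k) * (M - 𝔼 k, y k) := by
  rw [expect_sub_expect_sq]
  have : 𝔼 j, y j ^ 2 ≤ M * 𝔼 j, y j := by
    rw [Finset.mul_expect]
    refine Finset.expect_le_expect fun j _ => ?_
    nlinarith [hy j, hM j]
  linarith

theorem freq_sum_upper_le {y : ι → ℝ} {M l : ℝ} {m : ℕ} (hm : 0 < m) (hy : ∀ j, 0 ≤ y j)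
    (hM : ∀ j, y j ≤ M) (hl : 0 ≤ l) :
    freq (fun ω : Fin m → ι => m * (𝔼 k, y k) + (√(2 * (m * ((𝔼 k, y k) * (M - 𝔼 k, y k))) * l)
      + 2 / 3 * (M - 𝔼 k, y k) * l) < ∑ i, y (ω i)) ≤ Real.exp (-l) := by
  set μ := 𝔼 k, y k with hμ
  have hμ0 : 0 ≤ μ := Finset.expect_nonneg fun _ _ => hy _
  have hμM : μ ≤ M := by
    calc μ ≤ 𝔼 _k : ι, M := Finset.expect_le_expect fun j _ => hM j
      _ = M := Fintype.expect_const _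
  have hb : 0 ≤ M - μ := by linarith
  have hv : 0 ≤ m * (μ * (M - μ)) := by positivity
  have h := freq_sum_gt_le (Z := fun j => y j - μ) hb (expect_sub_expect_self _)
    (fun j => by linarith [hM j]) (expect_sub_expect_sq_le_of_le hy hM) (by positivity) hm
    (bernstein_threshold hv hb hl)
  simp only [Finset.sum_sub_distrib, Finset.sum_const, Finset.card_univ, Fintype.card_fin,
    nsmul_eq_mul, lt_sub_iff_add_lt'] at h
  exact h

/-- Downward deviations are bounded by the mean, since `y ≥ 0`, rather than by `M` minus the mean.
The linear term therefore differs from the one in the upper tail. -/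
theorem freq_sum_lower_le {y : ι → ℝ} {M l : ℝ} {m : ℕ} (hm : 0 < m) (hy : ∀ j, 0 ≤ y j)
    (hM : ∀ j, y j ≤ M) (hl : 0 ≤ l) :
    freq (fun ω : Fin m → ι => ∑ i, y (ω i) < m * (𝔼 k, y k)
      - (√(2 * (m * ((𝔼 k, y k) * (M - 𝔼 k, y k))) * l) + 2 / 3 * (𝔼 k, y k) * l))
      ≤ Real.exp (-l) := by
  set μ := 𝔼 k, y k with hμ
  have hμ0 : 0 ≤ μ := Finset.expect_nonneg fun _ _ => hy _
  have hμM : μ ≤ M := by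
    calc μ ≤ 𝔼 _k : ι, M := Finset.expect_le_expect fun j _ => hM j
      _ = M := Fintype.expect_const _
  have hb : 0 ≤ M - μ := by linarith
  have hv : 0 ≤ m * (μ * (M - μ)) := by positivity
  have hV : 𝔼 j, (μ - y j) ^ 2 ≤ μ * (M - μ) := by
    refine le_trans (le_of_eq ?_) (expect_sub_expect_sq_le_of_le hy hM)
    exact Finset.expect_congr rfl fun j _ => by ring
  have hZ : 𝔼 j, (μ - y j) = 0 := by
    rw [Finset.expect_sub_distrib, Fintype.expect_const, sub_self]
  have h := freq_sum_gt_le (Z := fun j => μ - y j) hμ0 hZ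
    (fun j => by linarith [hy j]) hV (by positivity) hm (bernstein_threshold hv hμ0 hl)
  simp only [Finset.sum_sub_distrib, Finset.sum_const, Finset.card_univ, Fintype.card_fin,
    nsmul_eq_mul] at h
  simpa only [lt_sub_comm] using h

end Tails

/-! ### Slice projections compressed to a subspace. -/

section Slices

variable {H : Type*} [NormedAddCommGroup H] [InnerProductSpace ℝ H]

/-- Mutually orthogonal projections that sum to the identity. -/
structure IsSliceDecomposition {ι : Type*} [Fintype ι] (p : ι → H →ₗ[ℝ] H) : Prop where
  symm : ∀ j, (p j).IsSymmetric
  idem : ∀ j v, p j (p j v) = p j v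
  sum : ∀ v, ∑ j, p j v = v

variable {ι : Type*} [Fintype ι] {p : ι → H →ₗ[ℝ] H}

theorem IsSliceDecomposition.inner_eq (hp : IsSliceDecomposition p) (j : ι) (u v : H) :
    ⟪p j u, p j v⟫_ℝ = ⟪p j u, v⟫_ℝ := by
  rw [← hp.symm, hp.idem]

theorem IsSliceDecomposition.norm_sq (hp : IsSliceDecomposition p) (j : ι) (v : H) :
    ‖p j v‖ ^ 2 = ⟪v, p j v⟫_ℝ := by
  rw [← real_inner_self_eq_norm_sq, hp.inner_eq, real_inner_comm]

theorem IsSliceDecomposition.sum_norm_sq (hp : IsSliceDecomposition p) (v : H) :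
    ∑ j, ‖p j v‖ ^ 2 = ‖v‖ ^ 2 := by
  simp_rw [hp.norm_sq, ← inner_sum, hp.sum, real_inner_self_eq_norm_sq]

variable [FiniteDimensional ℝ H] (S : Submodule ℝ H)

/-- The compression of a slice projection to a subspace. -/
noncomputable def compress (p : ι → H →ₗ[ℝ] H) (j : ι) : S →ₗ[ℝ] S :=
  (S.orthogonalProjectionOnto : H →L[ℝ] S).toLinearMap ∘ₗ p j ∘ₗ S.subtype

variable {S}

omit [Fintype ι] in
theorem inner_compress (j : ι) (u v : S) :
    ⟪u, compress S p j v⟫_ℝ = ⟪(u : H), p j v⟫_ℝ := by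
  rw [compress, LinearMap.comp_apply, ContinuousLinearMap.coe_coe,
    Submodule.inner_orthogonalProjectionOnto_eq_of_mem_left]
  rfl

variable {R : ℝ}

theorem IsSliceDecomposition.isBoundedFrame (hp : IsSliceDecomposition p) (hR : 0 ≤ R)
    (h : ∀ j v, ‖S.orthogonalProjectionOnto (p j v)‖ ^ 2 ≤ R * ‖p j v‖ ^ 2) :
    IsBoundedFrame (compress S p) R where
  nonneg := hR
  symm j u v := by
    rw [inner_compress, real_inner_comm, inner_compress, real_inner_comm, hp.symm]
  sum_inner v := by
    simp_rw [inner_compress, ← hp.norm_sq, hp.sum_norm_sq]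
    rfl
  bound j v := by
    rw [inner_compress, ← hp.norm_sq]
    exact h j v

/-- Cauchy–Schwarz turns `bound` into `D j ≤ R`; summing over `j` compares the identity with `card ι
* R`. -/
theorem IsBoundedFrame.one_le_card_mul {E : Type*} [NormedAddCommGroup E] [InnerProductSpace ℝ E]
    {D : ι → E →ₗ[ℝ] E} (hD : IsBoundedFrame D R) [Nontrivial E] :
    1 ≤ Fintype.card ι * R := by
  obtain ⟨v, hv⟩ := exists_ne (0 : E)
  have hv' : 0 < ‖v‖ := norm_pos_iff.2 hv
  have h1 : ∀ j, ⟪v, D j v⟫_ℝ ≤ R * ‖v‖ ^ 2 := by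
    intro j
    have hb := hD.bound j v
    have hcs := real_inner_le_norm v (D j v)
    by_contra! hcon
    have h0 : 0 ≤ R * ‖v‖ ^ 2 := mul_nonneg hD.nonneg (sq_nonneg _)
    have h2 : ⟪v, D j v⟫_ℝ ^ 2 ≤ ‖v‖ ^ 2 * ‖D j v‖ ^ 2 := by
      rw [← mul_pow]
      exact pow_le_pow_left₀ (by linarith) hcs 2
    have h3 : ‖v‖ ^ 2 * ‖D j v‖ ^ 2 ≤ ‖v‖ ^ 2 * (R * ⟪v, D j v⟫_ℝ) := by gcongr
    nlinarith
  have h2 := hD.sum_inner v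
  have h3 : ∑ j, ⟪v, D j v⟫_ℝ ≤ ∑ _j : ι, R * ‖v‖ ^ 2 := Finset.sum_le_sum fun j _ => h1 j
  rw [h2, Finset.sum_const, Finset.card_univ, nsmul_eq_mul] at h3
  have : 0 < ‖v‖ ^ 2 := by positivity
  nlinarith

theorem IsBoundedFrame.freq_lt_le_half [Nonempty ι] {E : Type*} [NormedAddCommGroup E]
    [InnerProductSpace ℝ E] [FiniteDimensional ℝ E] {D : ι → E →ₗ[ℝ] E} (hD : IsBoundedFrame D R)
    [Nontrivial E] {d γ δ : ℝ} {m : ℕ} (hd : Module.finrank ℝ E ≤ d) (hδ : 0 < δ) (hm : 0 < m)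
    (hγ0 : 0 < γ)
    (hγ : γ ^ 2 = 8 * (Fintype.card ι * R) / (3 * m) * Real.log (2 * d / δ)) :
    freq (fun ω : Fin m → ι =>
      ∃ v, ∑ i, ⟪v, D (ω i) v⟫_ℝ < (1 - γ) * m / Fintype.card ι * ‖v‖ ^ 2) ≤ δ / 2 := by
  have hN := hD.one_le_card_mul
  have hn : (0 : ℝ) < Fintype.card ι := by exact_mod_cast Fintype.card_pos
  have hR : 0 < R := by
    by_contra! h
    have : Fintype.card ι * R ≤ 0 := mul_nonpos_of_nonneg_of_nonpos hn.le h
    linarith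
  have hm' : (0 : ℝ) < m := by exact_mod_cast hm
  have hd0 : 0 < d := lt_of_lt_of_le (by exact_mod_cast Module.finrank_pos) hd
  -- This `θ` maximises `γ θ - (2/3) R θ²`, and the resulting exponent `3 m γ² / (8 card R)` is the
  -- stated logarithm.
  have hθ : 0 < 3 / 4 * γ / R := by positivity
  refine (hD.freq_lt_le hθ m _).trans ?_
  have he : 3 / 4 * γ / R * ((1 - γ) * m / Fintype.card ι)
      - (1 - 2 / 3 * (3 / 4 * γ / R * R)) * (3 / 4 * γ / R) * m / Fintype.card ι
      = -Real.log (2 * d / δ) := by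
    have : Real.log (2 * d / δ) = 3 * m / (8 * (Fintype.card ι * R)) * γ ^ 2 := by
      rw [hγ]; field_simp
    rw [this]
    field_simp
    ring
  rw [he, Real.exp_neg, Real.exp_log (by positivity)]
  calc Module.finrank ℝ E * (2 * d / δ)⁻¹ ≤ d * (2 * d / δ)⁻¹ := by gcongr
    _ = δ / 2 := by field_simp

end Slices

/-! ### Numerical bookkeeping for the constants in `α`, `β` and `γ`. -/

theorem sqrt_ratio_le {κ m l N γ α β : ℝ} (hm : 0 < m) (hl : 0 ≤ l) (hκ : 1 ≤ κ) (hN : 1 ≤ N)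
    (hγ0 : 0 ≤ γ) (hγ1 : γ < 1) (hγ : 8 / 3 * (l / m) ≤ γ ^ 2)
    (hα : α = √(2 * ((κ - 1) * l / m)) + 2 / 3 * ((κ - 1) * l / m)) (hβ : 4 * l ≤ β)
    (h : N * (β / (1 - γ)) < m * (1 - α)) :
    √(κ * l / m) + √(l / m) ≤ 31 / 30 := by
  set r := l / m with hr
  have hr0 : 0 ≤ r := by positivity
  set x := (κ - 1) * l / m with hx
  have hx0 : 0 ≤ x := by
    have : 0 ≤ κ - 1 := by linarith
    positivity
  have hκr : κ * l / m = x + r := by rw [hx, hr]; ring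
  have hγ' : 0 < 1 - γ := by linarith
  have hβ0 : 0 ≤ β := by linarith
  have h1 : β / (1 - γ) ≤ N * (β / (1 - γ)) := le_mul_of_one_le_left (by positivity) hN
  have h2 : 4 * l / (1 - γ) ≤ β / (1 - γ) := by gcongr
  have hl' : l = m * r := by rw [hr]; field_simp
  have h3 : 4 * l / (1 - γ) < m * (1 - α) := by linarith
  rw [div_lt_iff₀ hγ', hl'] at h3
  have h4 : 4 * r < (1 - α) * (1 - γ) := by
    have : m * (4 * r) < m * ((1 - α) * (1 - γ)) := by linarith
    exact lt_of_mul_lt_mul_left this hm.le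
  have hα0 : 0 ≤ α := by rw [hα]; positivity
  have hα1 : α < 1 := by
    by_contra! hcon
    have : (1 - α) * (1 - γ) ≤ 0 := mul_nonpos_of_nonpos_of_nonneg (by linarith) hγ'.le
    linarith
  -- Positivity of the lower bound forces `α < 1`, while `x > 0.32` would give `α > 0.8 + 0.21`.
  have hx1 : x ≤ 32 / 100 := by
    by_contra! hcon
    have : (8 / 10 : ℝ) ≤ √(2 * x) := Real.le_sqrt_of_sq_le (by norm_num; linarith)
    linarith
  have h5 : 4 * r + γ < 1 := by nlinarith
  -- A larger `r` would push `γ` below `0.54` through `4r + γ < 1`, contradicting `γ² ≥ 8r/3`.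
  have hr1 : r ≤ 115 / 1000 := by
    by_contra! hcon
    have : γ < 54 / 100 := by linarith
    have : γ ^ 2 ≤ (54 / 100) ^ 2 := pow_le_pow_left₀ hγ0 this.le 2
    norm_num at this
    linarith
  have h6 : √(κ * l / m) ≤ 66 / 100 := by
    rw [hκr]
    exact Real.sqrt_le_iff.2 ⟨by norm_num, by norm_num; linarith⟩
  have h7 : √r ≤ 34 / 100 := Real.sqrt_le_iff.2 ⟨by norm_num, by norm_num; linarith⟩
  linarith

/-- The lower tail carries `(2/3) μ l`, which `α` does not account for. It fits into the gap between
`(1 + 2√l)²` and `(1 + (9/5)√l)²`, whose `l` coefficient is `19/25 > 2/3`; this is why the noise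
bound uses `9/5` instead of `2`. -/
theorem lower_threshold_le {m μ x l N γ α β : ℝ} (hm : 0 ≤ m) (hμ : 0 ≤ μ) (hl : 0 ≤ l)
    (hx : 0 ≤ x) (hN : 1 ≤ N) (hγ0 : 0 ≤ γ) (hγ1 : γ < 1)
    (hα : α = √(2 * x) + 2 / 3 * x) (hβ : β = (1 + 2 * √l) ^ 2) :
    (m * (1 - α) - N * (β / (1 - γ))) * μ + N * μ * ((1 + 9 / 5 * √l) ^ 2 / (1 - γ))
      ≤ m * μ - (m * μ * √(2 * x) + 2 / 3 * μ * l) := by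
  have hγ' : 0 < 1 - γ := by linarith
  have hs := Real.sqrt_nonneg l
  have hsq : √l ^ 2 = l := Real.sq_sqrt hl
  have h7 : 2 / 3 * l ≤ β - (1 + 9 / 5 * √l) ^ 2 := by
    rw [hβ]; nlinarith
  have h3 : 2 / 3 * l ≤ (β - (1 + 9 / 5 * √l) ^ 2) / (1 - γ) := by
    rw [le_div_iff₀ hγ']
    refine le_trans ?_ h7
    exact mul_le_of_le_one_right (by positivity) (by linarith)
  rw [sub_div] at h3
  set A := (1 + 9 / 5 * √l) ^ 2 / (1 - γ)
  set B := β / (1 - γ)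
  have h4 : 2 / 3 * l * μ ≤ N * (B - A) * μ := by
    refine mul_le_mul_of_nonneg_right ?_ hμ
    exact h3.trans (le_mul_of_one_le_left (by linarith [mul_nonneg hl hl]) hN)
  have h5 : 0 ≤ m * μ * (2 / 3 * x) := by positivity
  rw [hα]
  linarith

/-! ### Concentration and residual bounds for an abstract slice decomposition. -/

section Core

variable {ι H : Type*} [Fintype ι] [Nonempty ι] [NormedAddCommGroup H] [InnerProductSpace ℝ H]
  [FiniteDimensional ℝ H] {p : ι → H →ₗ[ℝ] H} {S : Submodule ℝ H} {R : ℝ} {Y : H}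

omit [Nonempty ι] in
theorem sum_orthogonalProjectionOnto_eq_zero (hp : IsSliceDecomposition p) (hY : Y ∈ Sᗮ) :
    ∑ j, S.orthogonalProjectionOnto (p j Y) = 0 := by
  rw [← map_sum, hp.sum]
  exact Submodule.orthogonalProjectionOnto_eq_zero_iff.2 hY

omit [Nonempty ι] [FiniteDimensional ℝ H] in
theorem expect_norm_sq_slice (hp : IsSliceDecomposition p) :
    𝔼 j, ‖p j Y‖ ^ 2 = ‖Y‖ ^ 2 / Fintype.card ι := by
  rw [Fintype.expect_eq_sum_div_card, hp.sum_norm_sq]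

/-- Concentration of the projected noise. -/
theorem freq_norm_sum_projection_gt_le (hp : IsSliceDecomposition p) (hR : 0 < R)
    (h : ∀ j v, ‖S.orthogonalProjectionOnto (p j v)‖ ^ 2 ≤ R * ‖p j v‖ ^ 2)
    (hY : Y ∈ Sᗮ) (hY0 : Y ≠ 0) {κ l : ℝ} {m : ℕ} (hm : 0 < m) (hl : 0 ≤ l)
    (hκ : ∀ j, ‖p j Y‖ ^ 2 ≤ κ * (‖Y‖ ^ 2 / Fintype.card ι))
    (hκl : √(κ * l / m) + √(l / m) ≤ 31 / 30) :
    freq (fun ω : Fin m → ι => √(m * (R * (‖Y‖ ^ 2 / Fintype.card ι))) * (1 + 9 / 5 * √l)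
      < ‖∑ i, S.orthogonalProjectionOnto (p (ω i) Y)‖) ≤ Real.exp (-l) := by
  set μ := ‖Y‖ ^ 2 / Fintype.card ι with hμ
  have hn : (0 : ℝ) < Fintype.card ι := by exact_mod_cast Fintype.card_pos
  have hm' : (0 : ℝ) < m := by exact_mod_cast hm
  have hμ0 : 0 < μ := by
    have := norm_pos_iff.2 hY0
    positivity
  have hκ0 : 0 ≤ κ := by
    have h1 := hκ (Classical.arbitrary ι)
    have h2 : 0 ≤ κ * μ := (sq_nonneg _).trans h1
    exact nonneg_of_mul_nonneg_left h2 hμ0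
  set σ := √(R * μ) with hσ
  have hσ0 : 0 < σ := Real.sqrt_pos.2 (by positivity)
  have hσ2 : σ ^ 2 = R * μ := Real.sq_sqrt (by positivity)
  have hb : ∀ j, ‖S.orthogonalProjectionOnto (p j Y)‖ ≤ √κ * σ := by
    intro j
    rw [hσ, ← Real.sqrt_mul hκ0]
    refine Real.le_sqrt_of_sq_le ((h j Y).trans ?_)
    have := mul_le_mul_of_nonneg_left (hκ j) hR.le
    linarith
  have hw : 𝔼 j, ‖S.orthogonalProjectionOnto (p j Y)‖ ^ 2 ≤ σ ^ 2 := by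
    rw [hσ2, hμ, ← expect_norm_sq_slice hp, Finset.mul_expect]
    exact Finset.expect_le_expect fun j _ => h j Y
  have ht : 0 ≤ √m * σ * (9 / 5 * √l) := by positivity
  -- Exactly what Bernstein needs at deviation `(9/5)√l √m σ`: `2 + (6/5)(31/30) = 81/25 = (9/5)²`.
  have hs : √l * √m * (√κ + 1) ≤ 31 / 30 * m := by
    have e1 : √(κ * l / m) = √κ * √l / √m := by
      rw [Real.sqrt_div (by positivity), Real.sqrt_mul hκ0]
    have e2 : √(l / m) = √l / √m := Real.sqrt_div hl _
    have hsm : 0 < √(m : ℝ) := Real.sqrt_pos.2 hm'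
    rw [e1, e2, ← add_div, div_le_iff₀ hsm] at hκl
    have := mul_le_mul_of_nonneg_right hκl hsm.le
    have e3 : √(m : ℝ) * √m = m := Real.mul_self_sqrt hm'.le
    nlinarith
  have key := freq_norm_sum_gt_le (l := l) (m := m) hb hσ0
    (sum_orthogonalProjectionOnto_eq_zero hp hY) hw ht hm (by
      have e3 : √(m : ℝ) ^ 2 = m := Real.sq_sqrt hm'.le
      have e4 : √l ^ 2 = l := Real.sq_sqrt hl
      have e5 : (√m * σ * (9 / 5 * √l)) ^ 2 = 81 / 25 * (m * l * σ ^ 2) := by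
        rw [mul_pow, mul_pow, mul_pow, e3, e4]; ring
      rw [e5]
      have e6 : 2 * l * (m * σ ^ 2 + (√κ * σ + σ) * (√m * σ * (9 / 5 * √l)) / 3)
          = 2 * (m * l * σ ^ 2) + 6 / 5 * (l * σ ^ 2) * (√l * √m * (√κ + 1)) := by ring
      rw [e6]
      have := mul_le_mul_of_nonneg_left hs (show 0 ≤ 6 / 5 * (l * σ ^ 2) by positivity)
      linarith)
  have e : √(m * (R * μ)) * (1 + 9 / 5 * √l) = √m * σ + √m * σ * (9 / 5 * √l) := by
    rw [Real.sqrt_mul hm'.le]; ring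
  rw [e]
  exact key

omit [Nonempty ι] in
/-- The residual lower bound on the good events. -/
theorem residual_lower_bound (hp : IsSliceDecomposition p) {m : ℕ} {ω : Fin m → ι} {c B Q : ℝ}
    (hc : 0 < c)
    (hS : ∀ Z ∈ S, c * ‖Z‖ ^ 2 ≤ ∑ i, ‖p (ω i) Z‖ ^ 2)
    (hW : ‖∑ i, S.orthogonalProjectionOnto (p (ω i) Y)‖ ^ 2 ≤ B)
    (hQ : Q + B / c ≤ ∑ i, ‖p (ω i) Y‖ ^ 2) {Z : H} (hZ : Z ∈ S) :
    Q ≤ ∑ i, ‖p (ω i) (Y - Z)‖ ^ 2 := by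
  set W := ∑ i, S.orthogonalProjectionOnto (p (ω i) Y) with hWdef
  have h1 : ∑ i, ⟪p (ω i) Y, p (ω i) Z⟫_ℝ = ⟪W, ⟨Z, hZ⟩⟫_ℝ := by
    rw [hWdef, sum_inner]
    refine Finset.sum_congr rfl fun i _ => ?_
    rw [hp.inner_eq, Submodule.inner_orthogonalProjectionOnto_eq_of_mem_right]
  have h2 : ⟪W, ⟨Z, hZ⟩⟫_ℝ ≤ ‖W‖ * ‖Z‖ := real_inner_le_norm W ⟨Z, hZ⟩
  have h3 : ∑ i, ‖p (ω i) (Y - Z)‖ ^ 2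
      = ∑ i, ‖p (ω i) Y‖ ^ 2 - 2 * ⟪W, ⟨Z, hZ⟩⟫_ℝ + ∑ i, ‖p (ω i) Z‖ ^ 2 := by
    rw [← h1, Finset.mul_sum, ← Finset.sum_sub_distrib, ← Finset.sum_add_distrib]
    refine Finset.sum_congr rfl fun i _ => ?_
    rw [map_sub, norm_sub_sq_real]
  have h4 := hS Z hZ
  -- Completing the square absorbs the cross term into the curvature `c` on `S`.
  have h5 : 2 * (‖W‖ * ‖Z‖) ≤ ‖W‖ ^ 2 / c + c * ‖Z‖ ^ 2 := by
    have : 0 ≤ (‖W‖ - c * ‖Z‖) ^ 2 / c := by positivity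
    have e : (‖W‖ - c * ‖Z‖) ^ 2 / c = ‖W‖ ^ 2 / c - 2 * (‖W‖ * ‖Z‖) + c * ‖Z‖ ^ 2 := by
      field_simp; ring
    linarith
  have h6 : ‖W‖ ^ 2 / c ≤ B / c := by gcongr
  linarith

/-- Sampling an orthogonal decomposition: with high probability the sampled slices preserve the
norm on `S` from below, and the sampled residual of `Y ∈ Sᗮ` is controlled from both sides. -/
theorem freq_not_good_le (hp : IsSliceDecomposition p) (hR : 0 ≤ R)
    (h : ∀ j v, ‖S.orthogonalProjectionOnto (p j v)‖ ^ 2 ≤ R * ‖p j v‖ ^ 2)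
    [Nontrivial S] (hY : Y ∈ Sᗮ) {δ α β γ d M N : ℝ} {m : ℕ} (hm : 0 < m)
    (hδ : 0 < δ) (hδ1 : δ < 1) (hd : Module.finrank ℝ S ≤ d) (hM : ∀ j, ‖p j Y‖ ^ 2 ≤ M)
    (hN : N = Fintype.card ι * R)
    (hα : α = √(2 * (Fintype.card ι * M - ‖Y‖ ^ 2) / (m * ‖Y‖ ^ 2) * Real.log (1 / δ))
      + 2 * (Fintype.card ι * M - ‖Y‖ ^ 2) / (3 * m * ‖Y‖ ^ 2) * Real.log (1 / δ))
    (hβ : β = (1 + 2 * √(Real.log (1 / δ))) ^ 2)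
    (hγ : γ = √(8 * N / (3 * m) * Real.log (2 * d / δ))) (hγ1 : γ < 1) :
    freq (fun ω : Fin m → ι => ¬ ((∀ Z ∈ S, (1 - γ) * m / Fintype.card ι * ‖Z‖ ^ 2
          ≤ ∑ i, ‖p (ω i) Z‖ ^ 2)
        ∧ (∀ Z ∈ S, (m * (1 - α) - N * (β / (1 - γ))) / Fintype.card ι * ‖Y‖ ^ 2
          ≤ ∑ i, ‖p (ω i) (Y - Z)‖ ^ 2)
        ∧ ∑ i, ‖p (ω i) Y‖ ^ 2 ≤ (1 + α) * (m / Fintype.card ι) * ‖Y‖ ^ 2)) ≤ 4 * δ := by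
  have hF := hp.isBoundedFrame hR h
  have hN1 : 1 ≤ N := hN ▸ hF.one_le_card_mul
  have hn : (0 : ℝ) < Fintype.card ι := by exact_mod_cast Fintype.card_pos
  set n : ℝ := (Fintype.card ι : ℝ) with hndef
  have hRpos : 0 < R := by
    by_contra! hcon
    have : n * R ≤ 0 := mul_nonpos_of_nonneg_of_nonpos hn.le hcon
    linarith
  have hm' : (0 : ℝ) < m := by exact_mod_cast hm
  set l := Real.log (1 / δ) with hl
  have hl0 : 0 ≤ l := Real.log_nonneg (by rw [le_div_iff₀ hδ]; linarith)
  have hexp : Real.exp (-l) = δ := by rw [hl, one_div, Real.log_inv, neg_neg, Real.exp_log hδ]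
  have hd1 : 1 ≤ d := by
    refine le_trans ?_ hd
    exact_mod_cast (Module.finrank_pos (R := ℝ) (M := S))
  have hlog : l ≤ Real.log (2 * d / δ) := by
    refine Real.log_le_log (by positivity) ?_
    gcongr
    linarith
  have hlogpos : 0 < Real.log (2 * d / δ) := by
    refine Real.log_pos ?_
    rw [lt_div_iff₀ hδ]
    linarith
  have hγarg : 0 < 8 * N / (3 * m) * Real.log (2 * d / δ) := by positivity
  have hγ0 : 0 < γ := hγ ▸ Real.sqrt_pos.2 hγarg
  have hγsq : γ ^ 2 = 8 * N / (3 * m) * Real.log (2 * d / δ) := by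
    rw [hγ, Real.sq_sqrt hγarg.le]
  have hγ' : 0 < 1 - γ := by linarith
  -- the sampled norm on the subspace
  have hbad1 := hF.freq_lt_le_half hd hδ hm hγ0 (by rw [hγsq, hN])
  set bad1 : (Fin m → ι) → Prop := fun ω =>
    ∃ v, ∑ i, ⟪v, compress S p (ω i) v⟫_ℝ < (1 - γ) * m / n * ‖v‖ ^ 2 with hb1
  have good1 : ∀ ω, ¬ bad1 ω →
      ∀ Z ∈ S, (1 - γ) * m / n * ‖Z‖ ^ 2 ≤ ∑ i, ‖p (ω i) Z‖ ^ 2 := by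
    intro ω hω Z hZ
    simp only [hb1, not_exists, not_lt] at hω
    have := hω ⟨Z, hZ⟩
    simp_rw [inner_compress, ← hp.norm_sq] at this
    exact this
  -- For `Y = 0` both residual bounds are multiples of zero, so only the eigenvalue event matters.
  rcases eq_or_ne Y 0 with rfl | hY0
  · refine (freq_le_add (q := bad1) (r := fun _ => False) fun ω hω => ?_).trans
      (by rw [freq_eq_zero (fun _ => not_false)]; linarith)
    left
    by_contra hcon
    refine hω ⟨good1 ω hcon, fun Z _ => ?_, ?_⟩
    · simp only [norm_zero]
      norm_num
      exact Finset.sum_nonneg fun _ _ => sq_nonneg _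
    · simp
  have hYpos : 0 < ‖Y‖ := norm_pos_iff.2 hY0
  set μ := ‖Y‖ ^ 2 / n with hμ
  have hμ0 : 0 < μ := by positivity
  have hYμ : ‖Y‖ ^ 2 = n * μ := by rw [hμ]; field_simp
  have hmean : 𝔼 j, ‖p j Y‖ ^ 2 = μ := expect_norm_sq_slice hp
  have hμM : μ ≤ M := by
    rw [← hmean]
    calc _ ≤ 𝔼 _k : ι, M := Finset.expect_le_expect fun j _ => hM j
      _ = M := Fintype.expect_const _
  set κ := M / μ with hκdef
  have hMκ : M = κ * μ := by rw [hκdef]; field_simp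
  have hκ1 : 1 ≤ κ := by rw [hκdef, le_div_iff₀ hμ0]; linarith
  have hκ0 : 0 ≤ κ - 1 := by linarith
  set x := (κ - 1) * l / m with hx
  have hx0 : 0 ≤ x := by positivity
  have hα' : α = √(2 * x) + 2 / 3 * x := by
    rw [hα, hYμ, hMκ]
    have e1 : 2 * (n * (κ * μ) - n * μ) / (m * (n * μ)) * l = 2 * x := by
      rw [hx]; field_simp
    have e2 : 2 * (n * (κ * μ) - n * μ) / (3 * m * (n * μ)) * l = 2 / 3 * x := by
      rw [hx]; field_simp
    rw [e1, e2]
  have hxm : m * μ * √(2 * x) = √(2 * (m * (μ * (M - μ))) * l) := by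
    have e : 2 * (m * (μ * (M - μ))) * l = (m * μ) ^ 2 * (2 * x) := by
      rw [hx, hMκ]; field_simp
    rw [e, Real.sqrt_mul (sq_nonneg _), Real.sqrt_sq (by positivity)]
  have hxm2 : m * μ * (2 / 3 * x) = 2 / 3 * (M - μ) * l := by
    rw [hx, hMκ]; field_simp
  -- the upper tail
  have hbad2 := freq_sum_upper_le (l := l) hm (fun j => sq_nonneg ‖p j Y‖) hM hl0
  rw [hmean, hexp] at hbad2
  set bad2 : (Fin m → ι) → Prop := fun ω =>
    m * μ + (√(2 * (m * (μ * (M - μ))) * l) + 2 / 3 * (M - μ) * l) < ∑ i, ‖p (ω i) Y‖ ^ 2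
    with hb2
  have good2 : ∀ ω, ¬ bad2 ω → ∑ i, ‖p (ω i) Y‖ ^ 2 ≤ (1 + α) * (m / n) * ‖Y‖ ^ 2 := by
    intro ω hω
    simp only [hb2, not_lt] at hω
    rw [← hxm, ← hxm2] at hω
    have : (1 + α) * (m / n) * ‖Y‖ ^ 2 = m * μ + (m * μ * √(2 * x) + m * μ * (2 / 3 * x)) := by
      rw [hα', hμ]; field_simp
    rw [this]
    exact hω
  -- A nonpositive coefficient makes the lower bound trivial; otherwise its positivity supplies the
  -- range condition through `sqrt_ratio_le`.
  rcases le_or_gt (m * (1 - α)) (N * (β / (1 - γ))) with htriv | htriv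
  · refine (freq_le_add (q := bad1) (r := bad2) fun ω hω => ?_).trans (by linarith)
    by_contra! hcon
    refine hω ⟨good1 ω hcon.1, fun Z _ => ?_, good2 ω hcon.2⟩
    refine le_trans ?_ (Finset.sum_nonneg fun _ _ => sq_nonneg _)
    refine mul_nonpos_of_nonpos_of_nonneg ?_ (sq_nonneg _)
    exact div_nonpos_of_nonpos_of_nonneg (by linarith) hn.le
  -- the lower tail
  have hbad3 := freq_sum_lower_le (l := l) hm (fun j => sq_nonneg ‖p j Y‖) hM hl0
  rw [hmean, hexp] at hbad3
  set bad3 : (Fin m → ι) → Prop := fun ω => ∑ i, ‖p (ω i) Y‖ ^ 2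
    < m * μ - (√(2 * (m * (μ * (M - μ))) * l) + 2 / 3 * μ * l) with hb3
  have hβl : 4 * l ≤ β := by
    rw [hβ]; nlinarith [Real.sqrt_nonneg l, Real.sq_sqrt hl0]
  have hγr : 8 / 3 * (l / m) ≤ γ ^ 2 := by
    rw [hγsq]
    calc 8 / 3 * (l / m) = 8 * 1 / (3 * m) * l := by field_simp
      _ ≤ _ := by gcongr
  have hbad4 := freq_norm_sum_projection_gt_le hp hRpos h hY hY0 hm hl0
    (fun j => by rw [← hndef, ← hμ, ← hMκ]; exact hM j)
    (sqrt_ratio_le hm' hl0 hκ1 hN1 hγ0.le hγ1 hγr hα' hβl htriv)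
  rw [hexp, ← hndef, ← hμ] at hbad4
  set bad4 : (Fin m → ι) → Prop := fun ω => √(m * (R * μ)) * (1 + 9 / 5 * √l)
    < ‖∑ i, S.orthogonalProjectionOnto (p (ω i) Y)‖ with hb4
  have good3 : ∀ ω, ¬ bad1 ω → ¬ bad3 ω → ¬ bad4 ω →
      ∀ Z ∈ S, (m * (1 - α) - N * (β / (1 - γ))) / n * ‖Y‖ ^ 2
        ≤ ∑ i, ‖p (ω i) (Y - Z)‖ ^ 2 := by
    intro ω h1 h3 h4 Z hZ
    simp only [hb3, hb4, not_lt] at h3 h4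
    have hc : 0 < (1 - γ) * m / n := by positivity
    refine residual_lower_bound hp hc (good1 ω h1) (pow_le_pow_left₀ (norm_nonneg _) h4 2) ?_ hZ
    refine le_trans ?_ h3
    rw [mul_pow, Real.sq_sqrt (by positivity), ← hxm]
    have e1 : m * (R * μ) * (1 + 9 / 5 * √l) ^ 2 / ((1 - γ) * m / n)
        = N * μ * ((1 + 9 / 5 * √l) ^ 2 / (1 - γ)) := by
      rw [hN]; field_simp
    have e2 : (m * (1 - α) - N * (β / (1 - γ))) / n * ‖Y‖ ^ 2
        = (m * (1 - α) - N * (β / (1 - γ))) * μ := by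
      rw [hμ]; ring
    rw [e1, e2]
    exact lower_threshold_le hm'.le hμ0.le hl0 hx0 hN1 hγ0.le hγ1 hα' hβ
  -- The total failure frequency is `7δ/2`, within the allowed `4δ`.
  have hu1 : freq (fun ω => bad3 ω ∨ bad4 ω) ≤ δ + δ :=
    (freq_le_add fun _ hω => hω).trans (by linarith)
  have hu2 : freq (fun ω => bad1 ω ∨ bad2 ω) ≤ δ / 2 + δ :=
    (freq_le_add fun _ hω => hω).trans (by linarith)
  refine (freq_le_add (q := fun ω => bad3 ω ∨ bad4 ω) (r := fun ω => bad1 ω ∨ bad2 ω)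
    fun ω hω => ?_).trans (by linarith)
  by_contra! hcon
  exact hω ⟨good1 ω hcon.2.1, good3 ω hcon.2.1 hcon.1.1 hcon.1.2, good2 ω hcon.2.2⟩

end Core

/-! ### Parseval and tube multiplication. -/

section Tubes

variable {n₃ : ℕ} [NeZero n₃]

theorem tubeDFT_injective : Function.Injective (tubeDFT : Tube n₃ → ZMod n₃ → ℂ) := by
  intro a b h
  have := ZMod.dft.injective h
  funext k
  exact_mod_cast congrFun this k

theorem tubeDFT_add (a b : Tube n₃) : tubeDFT (a + b) = tubeDFT a + tubeDFT b := by
  rw [tubeDFT, tubeDFT, tubeDFT, ← map_add]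
  congr 1
  funext k
  simp

theorem tubeDFT_smul (r : ℝ) (a : Tube n₃) : tubeDFT (r • a) = (r : ℂ) • tubeDFT a := by
  rw [tubeDFT, tubeDFT, ← map_smul]
  congr 1
  funext k
  simp

theorem tubeDFT_zero : tubeDFT (0 : Tube n₃) = 0 := by
  have := tubeDFT_smul 0 (0 : Tube n₃)
  simpa using this

theorem tubeDFT_sum {κ : Type*} (s : Finset κ) (f : κ → Tube n₃) :
    tubeDFT (∑ i ∈ s, f i) = ∑ i ∈ s, tubeDFT (f i) :=
  map_sum (AddMonoidHom.mk' (tubeDFT : Tube n₃ → ZMod n₃ → ℂ) tubeDFT_add) f s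

theorem parseval_inner (a b : Tube n₃) :
    ∑ k, tubeDFT a k * star (tubeDFT b k) = n₃ * ((∑ k, a k * b k : ℝ) : ℂ) := by
  have hn : (n₃ : ℂ) ≠ 0 := by exact_mod_cast NeZero.ne n₃
  have hb : ∀ j, ∑ k, ZMod.stdAddChar (k * j) * tubeDFT b k = n₃ * (b j : ℂ) := by
    intro j
    have h : ZMod.dft.symm (tubeDFT b) j = (b j : ℂ) := by
      rw [tubeDFT, LinearEquiv.symm_apply_apply]
    rw [ZMod.invDFT_apply] at h
    simp only [smul_eq_mul] at h
    rw [← h, mul_inv_cancel_left₀ hn]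
  have h1 : ∀ k, tubeDFT a k = ∑ j, ZMod.stdAddChar (-(j * k)) * (a j : ℂ) := by
    intro k
    rw [tubeDFT, ZMod.dft_apply]
    simp
  calc ∑ k, tubeDFT a k * star (tubeDFT b k)
      = ∑ k, ∑ j, ZMod.stdAddChar (-(j * k)) * (a j : ℂ) * tubeDFT b (-k) := by
        refine Finset.sum_congr rfl fun k _ => ?_
        rw [tubeDFT_neg, h1, Finset.sum_mul]
    _ = ∑ j, (a j : ℂ) * ∑ k, ZMod.stdAddChar (-(j * k)) * tubeDFT b (-k) := by
        rw [Finset.sum_comm]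
        refine Finset.sum_congr rfl fun j _ => ?_
        rw [Finset.mul_sum]
        exact Finset.sum_congr rfl fun k _ => by ring
    _ = ∑ j, (a j : ℂ) * (n₃ * (b j : ℂ)) := by
        refine Finset.sum_congr rfl fun j _ => ?_
        rw [← hb j, ← Equiv.sum_comp (Equiv.neg (ZMod n₃))]
        congr 1
        refine Finset.sum_congr rfl fun k _ => ?_
        simp [mul_comm]
    _ = _ := by
        push_cast
        rw [Finset.mul_sum]
        exact Finset.sum_congr rfl fun j _ => by ring

theorem parseval (a : Tube n₃) : ∑ k, ‖tubeDFT a k‖ ^ 2 = n₃ * ∑ k, a k ^ 2 := by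
  have h := parseval_inner a a
  have h2 : ∀ k, tubeDFT a k * star (tubeDFT a k) = ((‖tubeDFT a k‖ ^ 2 : ℝ) : ℂ) := fun k => by
    rw [Complex.star_def, Complex.mul_conj, Complex.normSq_eq_norm_sq]
  simp_rw [h2] at h
  have h3 : ∀ k, a k ^ 2 = a k * a k := fun k => sq _
  simp_rw [h3]
  exact_mod_cast h

/-- In the transform domain the product is entrywise, and Parseval for the unnormalised transform
leaves one factor `n₃`. This is the origin of `n₃` beside the coherence. -/
theorem sum_sq_tubeMul_le (a b : Tube n₃) :
    ∑ k, tubeMul a b k ^ 2 ≤ n₃ * (∑ k, a k ^ 2) * ∑ k, b k ^ 2 := by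
  have hn : (0 : ℝ) < n₃ := by exact_mod_cast NeZero.pos n₃
  have h := parseval (tubeMul a b)
  simp_rw [tubeDFT_tubeMul, norm_mul, mul_pow] at h
  have h2 : ∑ k, ‖tubeDFT a k‖ ^ 2 * ‖tubeDFT b k‖ ^ 2
      ≤ (∑ k, ‖tubeDFT a k‖ ^ 2) * ∑ k, ‖tubeDFT b k‖ ^ 2 := by
    rw [Finset.mul_sum]
    refine Finset.sum_le_sum fun k _ => mul_le_mul_of_nonneg_right ?_ (sq_nonneg _)
    exact Finset.single_le_sum (f := fun k => ‖tubeDFT a k‖ ^ 2) (fun _ _ => sq_nonneg _)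
      (Finset.mem_univ k)
  rw [h, parseval, parseval] at h2
  refine le_of_mul_le_mul_left (h2.trans (le_of_eq ?_)) hn
  ring

/-- The adjoint of multiplication by a tube is multiplication by the tube with conjugate transform;
hence `ltranspose` is the adjoint for the real inner product. -/
theorem tubeMul_dot (a b c : Tube n₃) :
    ∑ k, tubeMul a b k * c k = ∑ k, b k * tubeMul (invDFT fun l => star (tubeDFT a l)) c k := by
  have hn : (n₃ : ℂ) ≠ 0 := by exact_mod_cast NeZero.ne n₃
  have h1 := parseval_inner (tubeMul a b) c
  have h2 := parseval_inner b (tubeMul (invDFT fun l => star (tubeDFT a l)) c)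
  have h3 : ∑ k, tubeDFT (tubeMul a b) k * star (tubeDFT c k)
      = ∑ k, tubeDFT b k
        * star (tubeDFT (tubeMul (invDFT fun l => star (tubeDFT a l)) c) k) := by
    refine Finset.sum_congr rfl fun k _ => ?_
    rw [tubeDFT_tubeMul, tubeDFT_tubeMul, tubeDFT_invDFT _ (fun k => by rw [tubeDFT_neg]),
      star_mul', star_star]
    ring
  rw [h3, h2] at h1
  exact_mod_cast (mul_left_cancel₀ hn h1).symm

theorem zero_tubeMul (a : Tube n₃) : tubeMul 0 a = 0 := by
  refine tubeDFT_injective (funext fun k => ?_)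
  simp [tubeDFT_tubeMul, tubeDFT_zero]

theorem tubeOne_tubeMul (a : Tube n₃) : tubeMul tubeOne a = a := by
  refine tubeDFT_injective (funext fun k => ?_)
  simp [tubeDFT_tubeMul, tubeDFT_tubeOne]

end Tubes

/-! ### Tensor algebra through frontal slices of the transform. -/

section Tensors

variable {n₁ n₂ n₃ n₄ n₅ : ℕ} [NeZero n₃]

/-- The frontal slices of the transform of a tensor. -/
noncomputable def frontalDFT (A : Tensor n₁ n₂ n₃) (k : ZMod n₃) : Matrix (Fin n₁) (Fin n₂) ℂ :=
  Matrix.of fun i j => tubeDFT (A i j) k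

theorem frontalDFT_injective :
    Function.Injective (frontalDFT : Tensor n₁ n₂ n₃ → ZMod n₃ → Matrix (Fin n₁) (Fin n₂) ℂ) := by
  intro A B h
  funext i j
  exact tubeDFT_injective (funext fun k => congrFun (congrFun (congrFun h k) i) j)

theorem frontalDFT_lprod (A : Tensor n₁ n₂ n₃) (B : Tensor n₂ n₄ n₃) (k : ZMod n₃) :
    frontalDFT (lprod A B) k = frontalDFT A k * frontalDFT B k := by
  ext i j
  simp [frontalDFT, lprod, tubeDFT_sum, Matrix.mul_apply, tubeDFT_tubeMul]

theorem frontalDFT_lone (n : ℕ) (k : ZMod n₃) : frontalDFT (lone n n₃) k = 1 := by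
  ext i j
  rw [frontalDFT, Matrix.of_apply, lone, Matrix.one_apply]
  split_ifs
  · exact tubeDFT_tubeOne k
  · simp [tubeDFT_zero]

theorem frontalDFT_add (A B : Tensor n₁ n₂ n₃) :
    frontalDFT (A + B) = frontalDFT A + frontalDFT B := by
  funext k; ext i j
  simp [frontalDFT, tubeDFT_add]

theorem frontalDFT_smul (r : ℝ) (A : Tensor n₁ n₂ n₃) :
    frontalDFT (r • A) = (r : ℂ) • frontalDFT A := by
  funext k; ext i j
  simp [frontalDFT, tubeDFT_smul]

theorem lprod_assoc (A : Tensor n₁ n₂ n₃) (B : Tensor n₂ n₄ n₃) (C : Tensor n₄ n₅ n₃) :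
    lprod (lprod A B) C = lprod A (lprod B C) := by
  refine frontalDFT_injective (funext fun k => ?_)
  simp only [frontalDFT_lprod, Matrix.mul_assoc]

theorem lone_lprod (A : Tensor n₁ n₂ n₃) : lprod (lone n₁ n₃) A = A := by
  refine frontalDFT_injective (funext fun k => ?_)
  rw [frontalDFT_lprod, frontalDFT_lone, Matrix.one_mul]

theorem lprod_lone (A : Tensor n₁ n₂ n₃) : lprod A (lone n₂ n₃) = A := by
  refine frontalDFT_injective (funext fun k => ?_)
  rw [frontalDFT_lprod, frontalDFT_lone, Matrix.mul_one]

/-- Multiplication by a tensor as a linear map on tensor columns. -/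
noncomputable def lprodLin (A : Tensor n₁ n₂ n₃) : Tensor n₂ 1 n₃ →ₗ[ℝ] Tensor n₁ 1 n₃ where
  toFun := lprod A
  map_add' B C := by
    refine frontalDFT_injective (funext fun k => ?_)
    simp only [frontalDFT_lprod, frontalDFT_add, Pi.add_apply, Matrix.mul_add]
  map_smul' r B := by
    refine frontalDFT_injective (funext fun k => ?_)
    simp only [frontalDFT_lprod, frontalDFT_smul, Pi.smul_apply, Matrix.mul_smul, RingHom.id_apply]

theorem lprodLin_apply (A : Tensor n₁ n₂ n₃) (B : Tensor n₂ 1 n₃) :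
    lprodLin A B = lprod A B := rfl

theorem columnSpace_eq (A : Tensor n₁ n₂ n₃) :
    columnSpace A = Set.range (lprodLin A) := by
  have key : ∀ c : Fin n₂ → Tensor 1 1 n₃,
      ∑ j, lprod (column A j) (c j) = lprod A fun j _ => c j 0 0 := by
    intro c
    funext i t
    rw [Subsingleton.elim t 0]
    simp [lprod, column, Finset.sum_apply]
  ext X
  constructor
  · rintro ⟨c, rfl⟩
    exact ⟨fun j _ => c j 0 0, (key c).symm⟩
  · rintro ⟨c, rfl⟩
    refine ⟨fun j _ _ => c j 0, ?_⟩
    rw [key, lprodLin_apply]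
    congr 1
    funext j t
    rw [Subsingleton.elim t 0]

theorem isInverse_linv {n : ℕ} {B : Tensor n n n₃} (h : IsInvertible B) :
    IsInverse B (linv B) := by
  rw [linv, dif_pos h]
  exact h.choose_spec

theorem lprod_dot (A : Tensor n₁ n₂ n₃) (X : Tensor n₂ 1 n₃) (Y : Tensor n₁ 1 n₃) :
    ∑ i, ∑ k, lprod A X i 0 k * Y i 0 k = ∑ i, ∑ k, X i 0 k * lprod (ltranspose A) Y i 0 k := by
  simp only [lprod, Finset.sum_apply, Finset.sum_mul, Finset.mul_sum]
  have h1 : ∀ i, ∑ k, ∑ s, tubeMul (A i s) (X s 0) k * Y i 0 k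
      = ∑ s, ∑ k, X s 0 k * tubeMul (ltranspose A s i) (Y i 0) k := by
    intro i
    rw [Finset.sum_comm]
    exact Finset.sum_congr rfl fun s _ => tubeMul_dot _ _ _
  simp_rw [h1]
  rw [Finset.sum_comm]
  exact Finset.sum_congr rfl fun s _ => Finset.sum_comm

theorem frobNorm_sq (X : Tensor n₁ 1 n₃) : frobNorm X ^ 2 = ∑ i, ∑ k, X i 0 k ^ 2 := by
  rw [frobNorm, Real.sq_sqrt (by positivity)]
  simp

/-- If multiplication by `V` is injective on tensor columns then `V† • V` is invertible. -/
theorem isInvertible_gram {V : Tensor n₁ n₂ n₃}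
    (hV : ∀ c : Tensor n₂ 1 n₃, lprod V c = 0 → c = 0) :
    IsInvertible (lprod (ltranspose V) V) := by
  set G := lprod (ltranspose V) V with hG
  -- If `G c = 0` then `‖V c‖² = ⟨c, G c⟩ = 0`. Finite dimension then gives surjectivity, and a
  -- right inverse is assembled column by column.
  have hinj : Function.Injective (lprodLin G) := by
    rw [← LinearMap.ker_eq_bot, LinearMap.ker_eq_bot']
    intro c hc
    refine hV c ?_
    have h1 := lprod_dot V c (lprod V c)
    rw [← lprod_assoc, ← hG, ← lprodLin_apply G, hc] at h1
    simp only [Pi.zero_apply, mul_zero, Finset.sum_const_zero] at h1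
    have h2 : ∀ i k, lprod V c i 0 k * lprod V c i 0 k = 0 := by
      intro i k
      have h3 := (Finset.sum_eq_zero_iff_of_nonneg
        (fun i _ => Finset.sum_nonneg fun k _ => mul_self_nonneg _)).1 h1 i (Finset.mem_univ i)
      exact (Finset.sum_eq_zero_iff_of_nonneg (fun k _ => mul_self_nonneg _)).1 h3 k
        (Finset.mem_univ k)
    funext i t k
    rw [Subsingleton.elim t 0]
    exact mul_self_eq_zero.1 (h2 i k)
  have hsurj : Function.Surjective (lprodLin G) := LinearMap.injective_iff_surjective.1 hinj
  have hcol : ∀ {n : ℕ} (A : Tensor n₂ n n₃) (j : Fin n),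
      column (lprod G A) j = lprod G (column A j) := fun _ _ => rfl
  choose C hC using fun j => hsurj (column (lone n₂ n₃) j)
  have h1 : lprod G (fun i j => C j i 0) = lone n₂ n₃ := by
    funext i j
    have h2 : C j = column (fun i j => C j i 0) j := by
      funext i t
      rw [Subsingleton.elim t 0]
      rfl
    have h3 := hC j
    rw [h2, lprodLin_apply, ← hcol] at h3
    exact congrFun (congrFun h3 i) 0
  refine ⟨fun i j => C j i 0, h1, ?_⟩
  have h2 : lprod G (lprod (fun i j => C j i 0) G) = lprod G (lone n₂ n₃) := by
    rw [← lprod_assoc, h1, lone_lprod, lprod_lone]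
  funext i j
  have h3 := congrArg (fun A => column A j) h2
  simp only [hcol] at h3
  exact congrFun (congrFun (hinj h3) i) 0

theorem lprod_proj (U : Tensor n₁ n₂ n₃) (T : Tensor n₁ n₄ n₃) :
    lprod (proj U) T
      = lprod U (lprod (linv (lprod (ltranspose U) U)) (lprod (ltranspose U) T)) := by
  rw [proj, lprod_assoc, lprod_assoc]

theorem ltranspose_lprod_proj {U : Tensor n₁ n₂ n₃} (hU : IsInvertible (lprod (ltranspose U) U))
    (T : Tensor n₁ n₄ n₃) : lprod (ltranspose U) (lprod (proj U) T) = lprod (ltranspose U) T := by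
  rw [lprod_proj, ← lprod_assoc, ← lprod_assoc, (isInverse_linv hU).1, lone_lprod]

theorem eq_zero_of_lprod_eq_zero {U : Tensor n₁ n₂ n₃}
    (hU : IsInvertible (lprod (ltranspose U) U)) {c : Tensor n₂ 1 n₃} (hc : lprod U c = 0) :
    c = 0 := by
  obtain ⟨C, -, hC⟩ := hU
  rw [← lone_lprod c, ← hC, lprod_assoc, lprod_assoc, hc, ← lprodLin_apply, ← lprodLin_apply,
    map_zero, map_zero]

end Tensors

/-! ### Tensor columns in Euclidean space and the coherence bound. -/

section Embedding

variable {n n₁ n₂ n₃ m : ℕ}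

/-- Tensor columns as vectors of a Euclidean space. -/
noncomputable def columnVec : Tensor n 1 n₃ →ₗ[ℝ] EuclideanSpace ℝ (Fin n × ZMod n₃) where
  toFun X := WithLp.toLp 2 fun q => X q.1 0 q.2
  map_add' _ _ := rfl
  map_smul' _ _ := rfl

theorem columnVec_apply (X : Tensor n 1 n₃) (q : Fin n × ZMod n₃) :
    columnVec X q = X q.1 0 q.2 := rfl

theorem columnVec_surjective :
    Function.Surjective
      (columnVec : Tensor n 1 n₃ → EuclideanSpace ℝ (Fin n × ZMod n₃)) :=
  fun v => ⟨fun i _ k => v (i, k), rfl⟩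

theorem columnVec_injective :
    Function.Injective
      (columnVec : Tensor n 1 n₃ → EuclideanSpace ℝ (Fin n × ZMod n₃)) := by
  intro X Y h
  funext i t k
  rw [Subsingleton.elim t 0]
  exact congrArg (fun v : EuclideanSpace ℝ (Fin n × ZMod n₃) => v (i, k)) h

/-- Restriction to one horizontal slice. -/
noncomputable def sliceProj (j : Fin n) :
    EuclideanSpace ℝ (Fin n × ZMod n₃) →ₗ[ℝ] EuclideanSpace ℝ (Fin n × ZMod n₃) where
  toFun v := WithLp.toLp 2 fun q => if q.1 = j then v q else 0
  map_add' u v := by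
    ext q
    by_cases h : q.1 = j <;> simp [h]
  map_smul' r v := by
    ext q
    by_cases h : q.1 = j <;> simp [h]

theorem sliceProj_apply (j : Fin n) (v : EuclideanSpace ℝ (Fin n × ZMod n₃))
    (q : Fin n × ZMod n₃) : sliceProj j v q = if q.1 = j then v q else 0 := rfl

variable [NeZero n₃]

theorem inner_columnVec (X Y : Tensor n 1 n₃) :
    ⟪columnVec X, columnVec Y⟫_ℝ = ∑ i, ∑ k, X i 0 k * Y i 0 k := by
  rw [PiLp.inner_apply, Fintype.sum_prod_type]
  refine Finset.sum_congr rfl fun i _ => Finset.sum_congr rfl fun k _ => ?_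
  simp [columnVec_apply, mul_comm]

theorem norm_columnVec_sq (X : Tensor n 1 n₃) : ‖columnVec X‖ ^ 2 = frobNorm X ^ 2 := by
  rw [← real_inner_self_eq_norm_sq, inner_columnVec, frobNorm_sq]
  simp_rw [sq]

theorem isSliceDecomposition_sliceProj :
    IsSliceDecomposition (sliceProj : Fin n → EuclideanSpace ℝ (Fin n × ZMod n₃) →ₗ[ℝ] _) where
  symm j u v := by
    rw [PiLp.inner_apply, PiLp.inner_apply]
    refine Finset.sum_congr rfl fun q _ => ?_
    rw [sliceProj_apply, sliceProj_apply]
    split_ifs <;> simp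
  idem j v := by
    ext q
    rw [sliceProj_apply, sliceProj_apply]
    split_ifs <;> rfl
  sum v := by
    ext q
    rw [WithLp.ofLp_sum, Finset.sum_apply]
    simp [sliceProj_apply]

theorem norm_sliceProj_sq (j : Fin n) (X : Tensor n 1 n₃) :
    ‖sliceProj j (columnVec X)‖ ^ 2 = ∑ k, X j 0 k ^ 2 := by
  rw [EuclideanSpace.norm_sq_eq, Fintype.sum_prod_type, Finset.sum_eq_single j]
  · refine Finset.sum_congr rfl fun k _ => ?_
    rw [sliceProj_apply, if_pos rfl, Real.norm_eq_abs, sq_abs, columnVec_apply]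
  · intro i _ hi
    refine Finset.sum_eq_zero fun k _ => ?_
    rw [sliceProj_apply, if_neg hi]
    simp
  · simp

/-- Writing a slice as a basis column times a tube lets `proj U` act on the basis column first,
where the coherence controls it. -/
theorem sliceProj_columnVec (j : Fin n) (X : Tensor n 1 n₃) :
    sliceProj j (columnVec X)
      = columnVec (lprod (basisColumn j) (fun _ _ => X j 0 : Tensor 1 1 n₃)) := by
  ext q
  rw [sliceProj_apply, columnVec_apply, columnVec_apply, lprod, Fin.sum_univ_one, basisColumn]
  split_ifs with h
  · rw [tubeOne_tubeMul, h]
  · rw [zero_tubeMul]; rfl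

theorem frobNorm_sample_sq (ω : Fin m → Fin n) (Z : Tensor n 1 n₃) :
    frobNorm (sample ω Z) ^ 2 = ∑ i, ‖sliceProj (ω i) (columnVec Z)‖ ^ 2 := by
  rw [frobNorm_sq]
  exact Finset.sum_congr rfl fun i _ => (norm_sliceProj_sq (ω i) Z).symm

theorem frobNorm_lprod_sq_le (B : Tensor n 1 n₃) (x : Tensor 1 1 n₃) :
    frobNorm (lprod B x) ^ 2 ≤ n₃ * frobNorm B ^ 2 * ∑ k, x 0 0 k ^ 2 := by
  rw [frobNorm_sq, frobNorm_sq, Finset.mul_sum Finset.univ _ (n₃ : ℝ), Finset.sum_mul]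
  refine Finset.sum_le_sum fun i _ => ?_
  rw [lprod, Fin.sum_univ_one]
  exact sum_sq_tubeMul_le _ _

/-- The column subspace inside the Euclidean space. -/
noncomputable def euclideanColumnSpace (U : Tensor n₁ n₂ n₃) :
    Submodule ℝ (EuclideanSpace ℝ (Fin n₁ × ZMod n₃)) :=
  LinearMap.range (columnVec ∘ₗ lprodLin U)

theorem columnVec_lprod_mem (U : Tensor n₁ n₂ n₃) (c : Tensor n₂ 1 n₃) :
    columnVec (lprod U c) ∈ euclideanColumnSpace U := ⟨c, rfl⟩

theorem finrank_euclideanColumnSpace_le (U : Tensor n₁ n₂ n₃) :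
    Module.finrank ℝ (euclideanColumnSpace U) ≤ n₂ * n₃ := by
  refine (LinearMap.finrank_range_le _).trans (le_of_eq ?_)
  simp [Tensor, Tube, Module.finrank_pi_fintype]

theorem orthComplement_columnVec {U : Tensor n₁ n₂ n₃} {Y : Tensor n₁ 1 n₃}
    (hY : Y ∈ orthComplement (columnSpace U)) : columnVec Y ∈ (euclideanColumnSpace U)ᗮ := by
  rw [Submodule.mem_orthogonal]
  rintro _ ⟨c, rfl⟩
  rw [LinearMap.comp_apply, inner_columnVec]
  exact hY _ (columnSpace_eq U ▸ ⟨c, rfl⟩)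

/-- The normal equations: `U†` annihilates `T - P • T`, so that difference is orthogonal to the
range of `U`. -/
theorem columnVec_proj {U : Tensor n₁ n₂ n₃} (hU : IsInvertible (lprod (ltranspose U) U))
    (T : Tensor n₁ 1 n₃) :
    columnVec (lprod (proj U) T)
      = (euclideanColumnSpace U).starProjection (columnVec T) := by
  symm
  refine Submodule.eq_starProjection_of_mem_of_inner_eq_zero ?_ ?_
  · rw [lprod_proj]
    exact columnVec_lprod_mem U _
  · rintro _ ⟨c, rfl⟩
    rw [LinearMap.comp_apply, ← map_sub, real_inner_comm, inner_columnVec, lprodLin_apply,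
      lprod_dot, ← lprodLin_apply (ltranspose U), map_sub, lprodLin_apply, lprodLin_apply,
      ltranspose_lprod_proj hU, sub_self]
    simp

theorem norm_projection_slice_sq_le {U : Tensor n₁ n₂ n₃}
    (hU : IsInvertible (lprod (ltranspose U) U)) (j : Fin n₁)
    (v : EuclideanSpace ℝ (Fin n₁ × ZMod n₃)) :
    ‖(euclideanColumnSpace U).orthogonalProjectionOnto (sliceProj j v)‖ ^ 2
      ≤ n₃ * (⨆ j : Fin n₁, frobNorm (lprod (proj U) (basisColumn j)) ^ 2)
        * ‖sliceProj j v‖ ^ 2 := by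
  obtain ⟨X, rfl⟩ := columnVec_surjective v
  have h1 : ‖(euclideanColumnSpace U).orthogonalProjectionOnto (sliceProj j (columnVec X))‖
      = ‖columnVec (lprod (lprod (proj U) (basisColumn j))
          (fun _ _ => X j 0 : Tensor 1 1 n₃))‖ := by
    rw [lprod_assoc, columnVec_proj hU, sliceProj_columnVec]
    rfl
  rw [h1, norm_columnVec_sq, norm_sliceProj_sq]
  refine (frobNorm_lprod_sq_le _ _).trans ?_
  gcongr
  exact le_ciSup (f := fun j => frobNorm (lprod (proj U) (basisColumn j)) ^ 2)
    (Set.finite_range _).bddAbove j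

theorem frobNorm_sub_proj_le {V : Tensor n₁ n₂ n₃} (hV : IsInvertible (lprod (ltranspose V) V))
    (T : Tensor n₁ 1 n₃) (c : Tensor n₂ 1 n₃) :
    frobNorm (T - lprod (proj V) T) ^ 2 ≤ frobNorm (T - lprod V c) ^ 2 := by
  set S := euclideanColumnSpace V
  rw [← norm_columnVec_sq, ← norm_columnVec_sq, map_sub, map_sub, columnVec_proj hV]
  have h1 : columnVec T - columnVec (lprod V c)
      = (columnVec T - S.starProjection (columnVec T))
        + (S.starProjection (columnVec T) - columnVec (lprod V c)) := by abel
  have h2 : ⟪columnVec T - S.starProjection (columnVec T),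
      S.starProjection (columnVec T) - columnVec (lprod V c)⟫_ℝ = 0 :=
    Submodule.starProjection_inner_eq_zero _ _
      (S.sub_mem (Submodule.starProjection_apply_mem _ _) (columnVec_lprod_mem V c))
  rw [h1, norm_add_sq_real, h2]
  nlinarith [sq_nonneg ‖S.starProjection (columnVec T) - columnVec (lprod V c)‖]

theorem sum_sq_le_inftyStarNorm_sq (X : Tensor n 1 n₃) (j : Fin n) :
    ∑ k, X j 0 k ^ 2 ≤ inftyStarNorm X ^ 2 := by
  have h : √(∑ k, X j 0 k ^ 2) ≤ inftyStarNorm X :=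
    le_ciSup (f := fun i => √(∑ k, X i 0 k ^ 2)) (Set.finite_range _).bddAbove j
  calc ∑ k, X j 0 k ^ 2 = √(∑ k, X j 0 k ^ 2) ^ 2 := (Real.sq_sqrt (by positivity)).symm
    _ ≤ _ := pow_le_pow_left₀ (Real.sqrt_nonneg _) h 2

end Embedding

end TubalSampling

/-! ### Assembly of the tensor statement. -/

open TubalSampling in
theorem corollary1 {n₁ n₂ n₃ m : ℕ} [NeZero n₃] (hn₂ : 0 < n₂)
    -- the subspace `S` is spanned by the columns of `U` and has dimension `n₂`
    (U : Tensor n₁ n₂ n₃) (hU : IsInvertible (lprod (ltranspose U) U))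
    -- the signal `T = X + Y` with `X ∈ S` and `Y ∈ S^⊥`
    (T X Y : Tensor n₁ 1 n₃) (hT : T = X + Y)
    (hX : X ∈ columnSpace U) (hY : Y ∈ orthComplement (columnSpace U))
    -- `m` tubes drawn uniformly with replacement
    {Ξ : Type*} [MeasurableSpace Ξ] (Pr : Measure Ξ) [IsProbabilityMeasure Pr]
    (Ω : Fin m → Ξ → Fin n₁) (hΩ_meas : ∀ i, Measurable (Ω i)) (hΩ_indep : iIndepFun Ω Pr)
    (hΩ_unif : ∀ i j, Pr.real {ξ | Ω i ξ = j} = 1 / n₁)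
    (δ α β γ : ℝ) (hδ : 0 < δ)
    (hm : 8 / 3 * n₂ * coherence U * Real.log (2 * n₂ * n₃ / δ) ≤ m)
    (hα : α = √(2 * (n₁ * inftyStarNorm Y ^ 2 - frobNorm Y ^ 2) / (m * frobNorm Y ^ 2)
              * Real.log (1 / δ))
            + 2 * (n₁ * inftyStarNorm Y ^ 2 - frobNorm Y ^ 2) / (3 * m * frobNorm Y ^ 2)
              * Real.log (1 / δ))
    (hβ : β = (1 + 2 * √(Real.log (1 / δ))) ^ 2)
    (hγ : γ = √(8 * n₃ * n₂ * coherence U / (3 * m) * Real.log (2 * n₂ * n₃ / δ)))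
    (hγ1 : γ < 1) :
    1 - 4 * δ ≤ Pr.real {ξ |
      IsInvertible (lprod (ltranspose (sample (fun i => Ω i ξ) U)) (sample (fun i => Ω i ξ) U)) ∧
      (m * (1 - α) - n₃ * n₂ * coherence U * (β / (1 - γ))) / n₁
          * frobNorm (T - lprod (proj U) T) ^ 2
        ≤ frobNorm (sample (fun i => Ω i ξ) T
            - lprod (proj (sample (fun i => Ω i ξ) U)) (sample (fun i => Ω i ξ) T)) ^ 2 ∧
      frobNorm (sample (fun i => Ω i ξ) T
            - lprod (proj (sample (fun i => Ω i ξ) U)) (sample (fun i => Ω i ξ) T)) ^ 2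
        ≤ (1 + α) * (m / n₁) * frobNorm (T - lprod (proj U) T) ^ 2} := by
  -- For `δ ≥ 1` the claimed probability is negative.
  rcases le_or_gt 1 δ with hδ1 | hδ1
  · exact le_trans (by linarith) measureReal_nonneg
  -- the ambient space is nontrivial
  obtain ⟨c₀, hc₀⟩ : ∃ c : Tensor n₂ 1 n₃, c ≠ 0 := by
    have : Nonempty (Fin n₂) := ⟨⟨0, hn₂⟩⟩
    exact ⟨fun _ _ _ => 1, fun h => one_ne_zero (congrFun (congrFun (congrFun h ⟨0, hn₂⟩) 0) 0)⟩
  have hUc₀ : lprod U c₀ ≠ 0 := fun h => hc₀ (eq_zero_of_lprod_eq_zero hU h)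
  have hne : Nonempty (Fin n₁) := by
    by_contra hcon
    rw [not_nonempty_iff] at hcon
    exact hUc₀ (funext fun i => hcon.elim i)
  set S := euclideanColumnSpace U with hS
  have hnt : Nontrivial S :=
    ⟨⟨⟨columnVec (lprod U c₀), columnVec_lprod_mem U c₀⟩, 0, fun h => hUc₀ <| by
      refine columnVec_injective ?_
      rw [map_zero]
      exact congrArg Subtype.val h⟩⟩
  have hp := isSliceDecomposition_sliceProj (n := n₁) (n₃ := n₃)
  set R : ℝ := n₃ * ⨆ j : Fin n₁, frobNorm (lprod (proj U) (basisColumn j)) ^ 2 with hRdef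
  have hR : 0 ≤ R := mul_nonneg (Nat.cast_nonneg _) (Real.iSup_nonneg fun _ => sq_nonneg _)
  have hbound := fun j v => norm_projection_slice_sq_le hU j v
  have hn₂' : (0 : ℝ) < n₂ := by exact_mod_cast hn₂
  have hn₃' : (0 : ℝ) < n₃ := by exact_mod_cast NeZero.pos n₃
  have hN : (n₃ : ℝ) * n₂ * coherence U = Fintype.card (Fin n₁) * R := by
    rw [coherence, hRdef, Fintype.card_fin]
    field_simp
  have hN1 : 1 ≤ (n₃ : ℝ) * n₂ * coherence U := by
    rw [hN]
    exact (hp.isBoundedFrame hR hbound).one_le_card_mul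
  have hn₁ : (0 : ℝ) < n₁ := by exact_mod_cast Fin.pos_iff_nonempty.2 hne
  have hm0 : 0 < m := by
    have hcoh : 0 < coherence U := by
      by_contra! hcon
      have : (n₃ : ℝ) * n₂ * coherence U ≤ 0 := mul_nonpos_of_nonneg_of_nonpos (by positivity) hcon
      linarith
    have hlog : 0 < Real.log (2 * n₂ * n₃ / δ) := by
      refine Real.log_pos ?_
      rw [lt_div_iff₀ hδ]
      have h2 : (1 : ℝ) ≤ n₂ := by exact_mod_cast hn₂
      have h3 : (1 : ℝ) ≤ n₃ := by exact_mod_cast NeZero.pos n₃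
      nlinarith
    have : (0 : ℝ) < m := lt_of_lt_of_le (by positivity) hm
    exact_mod_cast this
  have hYS := orthComplement_columnVec hY
  -- the residual of the full signal
  have hres : frobNorm (T - lprod (proj U) T) ^ 2 = ‖columnVec Y‖ ^ 2 := by
    rw [← norm_columnVec_sq, map_sub, columnVec_proj hU, hT, map_add]
    rw [columnSpace_eq] at hX
    obtain ⟨c, rfl⟩ := hX
    rw [lprodLin_apply,
      Submodule.eq_starProjection_of_mem_orthogonal' (columnVec_lprod_mem U c) hYS rfl,
      add_sub_cancel_left]
  have key := freq_not_good_le (m := m) (α := α) (β := β) (γ := γ) (M := inftyStarNorm Y ^ 2)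
    (d := (n₂ : ℝ) * n₃) hp hR hbound hYS hm0 hδ hδ1 (by exact_mod_cast finrank_euclideanColumnSpace_le U)
    (fun j => by rw [norm_sliceProj_sq]; exact sum_sq_le_inftyStarNorm_sq Y j) hN
    (by rw [norm_columnVec_sq, Fintype.card_fin]; exact hα) hβ
    (by rw [hγ]; simp only [mul_assoc]) hγ1
  rw [← measureReal_eq_freq hΩ_meas hΩ_indep hΩ_unif] at key
  have hmeas : Measurable fun ξ i => Ω i ξ := measurable_pi_lambda _ hΩ_meas
  set good : (Fin m → Fin n₁) → Prop := fun ω =>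
    (∀ Z ∈ S, (1 - γ) * m / Fintype.card (Fin n₁) * ‖Z‖ ^ 2 ≤ ∑ i, ‖sliceProj (ω i) Z‖ ^ 2)
      ∧ (∀ Z ∈ S, (m * (1 - α) - n₃ * n₂ * coherence U * (β / (1 - γ))) / Fintype.card (Fin n₁)
          * ‖columnVec Y‖ ^ 2 ≤ ∑ i, ‖sliceProj (ω i) (columnVec Y - Z)‖ ^ 2)
      ∧ ∑ i, ‖sliceProj (ω i) (columnVec Y)‖ ^ 2
          ≤ (1 + α) * (m / Fintype.card (Fin n₁)) * ‖columnVec Y‖ ^ 2 with hgood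
  have hcompl : 1 - 4 * δ ≤ Pr.real {ξ | good fun i => Ω i ξ} := by
    have hms : MeasurableSet {ξ | good fun i => Ω i ξ} :=
      hmeas (Set.toFinite {ω | good ω}).measurableSet
    have h1 := probReal_compl_eq_one_sub (μ := Pr) hms
    have h2 : {ξ | good fun i => Ω i ξ}ᶜ = {ξ | ¬ good fun i => Ω i ξ} := rfl
    rw [h2] at h1
    linarith
  refine hcompl.trans (measureReal_mono ?_)
  intro ξ hξ
  obtain ⟨h1, h2, h3⟩ := hξ
  rw [Set.mem_ofPred_eq, hres]
  rw [Fintype.card_fin] at h1 h2 h3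
  set ω : Fin m → Fin n₁ := fun i => Ω i ξ
  -- Sampling picks rows of tubes and hence commutes with multiplication on the right.
  have hsample : ∀ c : Tensor n₂ 1 n₃, lprod (sample ω U) c = sample ω (lprod U c) :=
    fun _ => rfl
  -- A `c` killed by the sampled `U` gives `U • c` zero sampled norm, so the lower bound on `S`
  -- forces `U • c = 0`.
  have hinv : IsInvertible (lprod (ltranspose (sample ω U)) (sample ω U)) := by
    refine isInvertible_gram fun c hc => eq_zero_of_lprod_eq_zero hU ?_
    have h4 := h1 _ (columnVec_lprod_mem U c)
    rw [← frobNorm_sample_sq, ← hsample, hc, ← norm_columnVec_sq, map_zero, norm_zero] at h4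
    have h5 : 0 < (1 - γ) * m / n₁ := by
      have : 0 < 1 - γ := by linarith
      positivity
    have h6 : ‖columnVec (lprod U c)‖ ^ 2 ≤ 0 := by
      by_contra! hcon
      have := mul_pos h5 hcon
      simp only [ne_eq, OfNat.ofNat_ne_zero, not_false_eq_true, zero_pow] at h4
      linarith
    refine columnVec_injective ?_
    rw [map_zero, ← norm_eq_zero]
    exact pow_eq_zero_iff two_ne_zero |>.1 (le_antisymm h6 (sq_nonneg _))
  rw [columnSpace_eq] at hX
  obtain ⟨cX, hcX⟩ := hX
  have hshift : ∀ c : Tensor n₂ 1 n₃, sample ω T - lprod (sample ω U) c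
      = sample ω (Y - lprod U (c - cX)) := by
    intro c
    rw [← lprodLin_apply U, map_sub, hcX, hT, hsample, lprodLin_apply]
    funext i
    simp only [sample, Pi.sub_apply, Pi.add_apply]
    abel
  refine ⟨hinv, ?_, ?_⟩
  · rw [lprod_proj, hshift, frobNorm_sample_sq, map_sub]
    exact h2 _ (columnVec_lprod_mem U _)
  -- The least squares residual is at most that of the coefficients of `X`, which leave exactly the
  -- sampled `Y`.
  · refine (frobNorm_sub_proj_le hinv (sample ω T) cX).trans ?_
    rw [hshift, sub_self, ← lprodLin_apply, map_zero, sub_zero, frobNorm_sample_sq]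
    exact h3
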